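/- **Conventions.** $\mathbb N=\{0,1,2,\dots\}$, $I=[0,1]$, "map" means continuous function, cardinals carry the discrete topology, compact spaces are Hausdorff, a space is *normal* if disjoint closed sets can be separated by open sets (no $T_1$ assumed), and $\operatorname{cov}(Y)$ is the set of open covers of $Y$. $\dim$ is the covering dimension ($\dim\emptyset=-1$). An *ANR* is a metrizable space that is an absolute neighbourhood retract for metrizable spaces. $Y$ is a *neighbourhood extensor* for $X$ if every map from a closed subset of $X$ to $Y$ extends to an open set containing it. A family of subsets of a space is *discrete* if every point of the space has a neighbourhood meeting at most one member of the family. $X$ is *FDT* if every open cover of $X$ has an open refinement (covering $X$) of finite order, and *locally FDT* if every point has an FDT neighbourhood. $\operatorname{comp}(X)$ is the least infinite cardinal $\alpha$ such that every open cover of $X$ has a subcover of cardinality $<\alpha$; $\operatorname{comp}_l(X)$ is the least infinite cardinal $\alpha$ such that every point of $X$ has a neighbourhood $F$ with $\operatorname{comp}(F)\le\alpha$. For a simplicial complex $\mathcal K$ (with vertices an orthonormal system in a Hilbert space), $|\mathcal K|_w$ and $|\mathcal K|_m$ denote its geometric realization with the weak topology and with the metric topology induced from the Hilbert space. Fix $\tau\in\{w,m\}$.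 For a cardinal $\alpha>0$ and $n\ge 1$, let $\mathcal E$ be a set of $\alpha$ vertices, fix $e\in\mathcal E$, and let $J_n(\alpha)$ be the complex of all nonempty finite $\sigma\subset\mathcal E$ with $\operatorname{card}(\sigma\cup\{e\})\le n+1$. Put $J(\alpha)=\bigoplus_{n=1}^\infty|J_n(\alpha)|_\tau$. For metrizable $Y$, the set $C(X,Y)$ of maps carries the limitation topology, in which the sets $B(f,\mathcal U)$, $\mathcal U\in\operatorname{cov}(Y)$, form a neighbourhood base at $f$; here $g\in B(f,\mathcal U)$ iff for every $x\in X$ some $U\in\mathcal U$ contains both $f(x)$ and $g(x)$. A set $D\subset C(X,Y)$ has *SMAP* (the small maps approximation property) if there is $\mathcal U\in\operatorname{cov}(Y)$ such that every map $g:X\to Y$ with $\overline{g(X)}\subset U$ for some $U\in\mathcal U$ belongs to $\overline D$. A class $\mathcal T$ of spaces is *closed hereditary* if closed subspaces of its members are members. A *normal system* over $Y$ on such a $\mathcal T$ is a family $\mathcal D=\{D_A\}_{A\in\mathcal T}$ such that for every $A\in\mathcal T$: * $D_A$ is an open subset of $C(A,Y)$; * if $g\in D_A$ and $B\subset A$ is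 closed, then $g|_B\in D_B$; * if $A=A_1\cup A_2$ with $A_1,A_2$ closed, $g\in C(A,Y)$ and $g|_{A_j}\in D_{A_j}$ for $j=1,2$, then $g\in D_A$; * if $A$ is the union of a discrete family $\{A_t\}_{t}$ of closed subsets, $g\in C(A,Y)$, $g|_{A_t}\in D_{A_t}$ for all $t$, and $\{g(A_t)\}_t$ is discrete in $Y$, then $g\in D_A$. It is *strongly normal* if, moreover, whenever $A\in\mathcal T$, $B\subset A$ is closed, $f\in C(A,Y)$ and $f|_B\in D_B$, there is a closed $K\subset A$ with $B\subset\operatorname{int}_AK$ and $f|_K\in D_K$. It is *transitive* if $g\circ f\in D_A$ whenever $A,B\in\mathcal T$, $f\in C(A,B)$ and $g\in D_B$. $\mathcal T$ is *corelated* to an ANR $Y$ if every member of $\mathcal T$ is a normal space for which $Y$ is a neighbourhood extensor, and for each $X\in\mathcal T$ there is an open cover $\mathcal V$ of $Y$ such that for every $V\in\mathcal V$: * (i) $\operatorname{comp}(\overline V)\le\operatorname{comp}_l(Y)$; * (ii) $\overline V$ is FDT if $Y$ is locally FDT; * (iii) for every map $f:X\to V$ and every $\mathcal U\in\operatorname{cov}(Y)$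 there are a simplicial complex $\mathcal K$ and maps $v:X\to|\mathcal K|_w$, $w:|\mathcal K|_m\to Y$ with $w\circ v\in B(f,\mathcal U)$ (identifying the underlying sets of $|\mathcal K|_w$ and $|\mathcal K|_m$), such that $\mathcal T$ contains a space homeomorphic to $|\mathcal K|_\tau$, $\mathcal K$ is locally finite dimensional, $\mathcal K$ has fewer than $\min(\operatorname{comp}(X),\operatorname{comp}(\overline V))$ vertices, $\dim\mathcal K\le\min(\dim X,\dim V)$, $\mathcal K$ is finite dimensional if $X$ or $\overline V$ is FDT, and $\mathcal K$ is locally finite if $V$ is separable. Finally, $\operatorname{comp}(\mathcal T\wedge Y)=\sup_{X\in\mathcal T}\min(\operatorname{comp}(X),\operatorname{comp}_l(Y))$ and $\dim(\mathcal T\wedge Y)=\sup_{X\in\mathcal T}\min(\dim X,\dim Y)$. Below, "$P\in\mathcal T$ and $D_P$ has SMAP" means that some space $Z\in\mathcal T$ homeomorphic to $P$ is such that $D_Z$ has SMAP (for transitive systems the choice of $Z$ is immaterial). **Theorem.** Let $Y$ be an ANR, $\mathcal T$ a closed hereditary class corelated to $Y$ (with respect to $\tau$), and $\mathcal D=\{D_A\}_{A\in\mathcal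 T}$ a transitive normal system over $Y$. In each of the following cases, $D_X$ is dense in $C(X,Y)$ for every $X\in\mathcal T$. * (I) $\mathcal T$ consists of compact spaces or $Y$ is locally compact, and for each $m\in\mathbb N\cap[0,\dim(\mathcal T\wedge Y)]$ there is $n\ge m$ such that $I^n\in\mathcal T$ and $D_{I^n}$ has SMAP. * (II) $\mathcal D$ is strongly normal, $\mathcal T$ consists of FDT spaces or $Y$ is locally FDT, and for each $m\in\mathbb N\cap[0,\dim(\mathcal T\wedge Y)]$ and each positive cardinal $\alpha<\operatorname{comp}(\mathcal T\wedge Y)$ there is $n\ge m$ such that $I^n\times\alpha\in\mathcal T$ and $D_{I^n\times\alpha}$ has SMAP. * (III) $\mathcal T$ consists of Lindelöf spaces or $Y$ is locally separable, $J=\bigoplus_{n=1}^\infty I^n\in\mathcal T$, and $D_J$ has SMAP. * (IV) For each positive cardinal $\alpha<\operatorname{comp}(\mathcal T\wedge Y)$, $J(\alpha)\in\mathcal T$ and $D_{J(\alpha)}$ has SMAP. -/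

import Mathlib

open Set Topology
open scoped Cardinal

universe u

namespace NormalSystems

noncomputable section

/-! ### Covers, finite-dimensional type, covering dimension, compactness numbers -/

/-- `𝒰` is an open cover of `X`, that is, `𝒰 ∈ cov(X)`. -/
def IsCov {X : Type*} [TopologicalSpace X] (𝒰 : Set (Set X)) : Prop :=
  (∀ U ∈ 𝒰, IsOpen U) ∧ ⋃₀ 𝒰 = univ

/-- `𝒱` refines `𝒰`. -/
def Refines {X : Type*} (𝒱 𝒰 : Set (Set X)) : Prop :=
  ∀ V ∈ 𝒱, ∃ U ∈ 𝒰, V ⊆ U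

/-- The order of the family `𝒰` is less than `n`: every point lies in at most `n` members. -/
def OrdLT {X : Type*} (𝒰 : Set (Set X)) (n : ℕ) : Prop :=
  ∀ x : X, {U ∈ 𝒰 | x ∈ U}.encard ≤ n

/-- `X` is of finite-dimensional type. -/
def FDT (X : Type*) [TopologicalSpace X] : Prop :=
  ∀ 𝒰 : Set (Set X), IsCov 𝒰 → ∃ 𝒱 : Set (Set X), IsCov 𝒱 ∧ Refines 𝒱 𝒰 ∧ ∃ n : ℕ, OrdLT 𝒱 n

/-- `X` is locally of finite-dimensional type. -/
def LocallyFDT (X : Type*) [TopologicalSpace X] : Prop :=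
  ∀ x : X, ∃ F ∈ 𝓝 x, FDT F

/-- The covering dimension of `X` is at most `n`. -/
def CovDimLE (X : Type*) [TopologicalSpace X] (n : ℕ) : Prop :=
  ∀ 𝒰 : Set (Set X), 𝒰.Finite → IsCov 𝒰 →
    ∃ 𝒱 : Set (Set X), IsCov 𝒱 ∧ Refines 𝒱 𝒰 ∧ OrdLT 𝒱 (n + 1)

open Classical in
/-- The covering dimension of `X`; the value `⊥` (usually written `-1`) is taken exactly when `X`
is empty. -/
def covDim (X : Type*) [TopologicalSpace X] : WithBot ℕ∞ :=
  if IsEmpty X then ⊥ else ((⨅ (n : ℕ) (_ : CovDimLE X n), (n : ℕ∞) : ℕ∞) : WithBot ℕ∞)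

/-- `comp(X)`: the least infinite cardinal `α` such that every open cover of `X` has a subcover of
cardinality less than `α`. -/
def comp (X : Type u) [TopologicalSpace X] : Cardinal.{u} :=
  sInf {α | ℵ₀ ≤ α ∧ ∀ 𝒰 : Set (Set X), IsCov 𝒰 → ∃ 𝒱 ⊆ 𝒰, ⋃₀ 𝒱 = univ ∧ #𝒱 < α}

/-- `comp_l(X)`: the least infinite cardinal `α` such that every point of `X` has a neighbourhood
`F` with `comp(F) ≤ α`. -/
def compLoc (X : Type u) [TopologicalSpace X] : Cardinal.{u} :=
  sInf {α | ℵ₀ ≤ α ∧ ∀ x : X, ∃ F ∈ 𝓝 x, comp F ≤ α}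

/-- Every point of `X` has a separable neighbourhood. -/
def LocallySeparable (X : Type*) [TopologicalSpace X] : Prop :=
  ∀ x : X, ∃ F ∈ 𝓝 x, TopologicalSpace.SeparableSpace F

/-! ### Neighbourhood extensors and ANR's -/

/-- `Y` is a neighbourhood extensor for `X`. -/
def NbhdExtensor (Y X : Type*) [TopologicalSpace Y] [TopologicalSpace X] : Prop :=
  ∀ A : Set X, IsClosed A → ∀ f : C(A, Y),
    ∃ (U : Set X) (_ : IsOpen U) (hAU : A ⊆ U) (g : C(U, Y)), ∀ a : A, g ⟨a, hAU a.2⟩ = f a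

/-- `Y` is a metrizable absolute neighbourhood retract for metrizable spaces: whenever `Y` is
embedded as a closed subset in a metrizable space `Z`, it is a retract of an open neighbourhood. -/
def IsANR (Y : Type u) [TopologicalSpace Y] : Prop :=
  TopologicalSpace.MetrizableSpace Y ∧
    ∀ (Z : Type u) [TopologicalSpace Z] [TopologicalSpace.MetrizableSpace Z] (i : Y → Z), IsClosedEmbedding i →
      ∃ (U : Set Z) (_ : IsOpen U) (hU : range i ⊆ U) (r : C(U, Y)),
        ∀ y : Y, r ⟨i y, hU (mem_range_self y)⟩ = y

/-! ### The limitation topology and the small maps approximation property -/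

section Maps

variable {X Y : Type*} [TopologicalSpace X] [TopologicalSpace Y]

/-- `f` and `g` are `𝒰`-close. -/
def Close (𝒰 : Set (Set Y)) (f g : X → Y) : Prop :=
  ∀ x, ∃ U ∈ 𝒰, f x ∈ U ∧ g x ∈ U

/-- `B(f, 𝒰)`: the set of all maps which are `𝒰`-close to `f`. -/
def coverBall (f : C(X, Y)) (𝒰 : Set (Set Y)) : Set C(X, Y) :=
  {g | Close 𝒰 f g}

theorem IsCov.inter {𝒰 𝒱 : Set (Set Y)} (h𝒰 : IsCov 𝒰) (h𝒱 : IsCov 𝒱) :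
    IsCov (image2 (· ∩ ·) 𝒰 𝒱) := by
  refine ⟨?_, ?_⟩
  · rintro _ ⟨U, hU, V, hV, rfl⟩
    exact (h𝒰.1 U hU).inter (h𝒱.1 V hV)
  · refine eq_univ_of_forall fun y => ?_
    obtain ⟨U, hU, hyU⟩ := (h𝒰.2 ▸ mem_univ y : y ∈ ⋃₀ 𝒰)
    obtain ⟨V, hV, hyV⟩ := (h𝒱.2 ▸ mem_univ y : y ∈ ⋃₀ 𝒱)
    exact ⟨U ∩ V, ⟨U, hU, V, hV, rfl⟩, hyU, hyV⟩

variable (X Y) in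
/-- The limitation topology on the set of maps from `X` to `Y`: a set is open if together with each
`f` it contains some `B(f, 𝒰)`. For paracompact `Y` the sets `B(f, 𝒰)`, with `𝒰 ∈ cov(Y)`, form a
neighbourhood base at `f`. -/
@[reducible]
def limitationTopology : TopologicalSpace C(X, Y) where
  IsOpen D := ∀ f ∈ D, ∃ 𝒰 : Set (Set Y), IsCov 𝒰 ∧ coverBall f 𝒰 ⊆ D
  isOpen_univ _ _ := ⟨{univ}, ⟨by simp, by simp⟩, subset_univ _⟩
  isOpen_inter D E hD hE f hf := by
    obtain ⟨𝒰, h𝒰, hD'⟩ := hD f hf.1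
    obtain ⟨𝒱, h𝒱, hE'⟩ := hE f hf.2
    refine ⟨_, h𝒰.inter h𝒱, fun g hg => ⟨hD' fun x => ?_, hE' fun x => ?_⟩⟩
    · obtain ⟨_, ⟨U, hU, V, hV, rfl⟩, h1, h2⟩ := hg x
      exact ⟨U, hU, h1.1, h2.1⟩
    · obtain ⟨_, ⟨U, hU, V, hV, rfl⟩, h1, h2⟩ := hg x
      exact ⟨V, hV, h1.2, h2.2⟩
  isOpen_sUnion S hS f := by
    rintro ⟨D, hDS, hfD⟩
    obtain ⟨𝒰, h𝒰, hD⟩ := hS D hDS f hfD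
    exact ⟨𝒰, h𝒰, hD.trans (subset_sUnion_of_mem hDS)⟩

variable (X) in
/-- The collection of all `𝓑`-small maps: those maps from `X` to `Y` for which the closure of the
image is contained in some member of `𝓑`. -/
def smallMaps (𝓑 : Set (Set Y)) : Set C(X, Y) :=
  {g | ∃ B ∈ 𝓑, closure (range g) ⊆ B}

/-- The small maps approximation property of a set `D` of maps from `X` to `Y`. -/
def SMAP (D : Set C(X, Y)) : Prop :=
  ∃ 𝒰 : Set (Set Y), IsCov 𝒰 ∧ smallMaps X 𝒰 ⊆ closure[limitationTopology X Y] D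

/-- `D` is dense in the limitation topology. -/
def LimDense (D : Set C(X, Y)) : Prop :=
  @Dense _ (limitationTopology X Y) D

/-- A family of subsets is discrete in `X` if every point of `X` has a neighbourhood which meets at
most one member of the family. -/
def DiscreteFamily {ι : Type*} (A : ι → Set X) : Prop :=
  ∀ x : X, ∃ F ∈ 𝓝 x, ∀ s t : ι, (F ∩ A s).Nonempty → (F ∩ A t).Nonempty → s = t

end Maps

/-! ### Normal systems

A class of spaces is a class of objects of `TopCat`. A system of sets of maps indexed by a class
`T` is a family `D` of sets of maps, of which only the members `D X` with `X ∈ T` matter. -/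

/-- With every space the class contains all closed subspaces of it. -/
def ClosedHereditary (T : Set TopCat.{u}) : Prop :=
  ∀ X ∈ T, ∀ A : Set X, IsClosed A → TopCat.of A ∈ T

section Systems

variable (Y : Type u) [TopologicalSpace Y] (T : Set TopCat.{u})
  (D : ∀ X : TopCat.{u}, Set C(X, Y))

/-- Normal systems over `Y` (for a closed hereditary class `T` and a paracompact space `Y`). -/
structure IsNormalSystem : Prop where
  /-- every member of the system is open in the limitation topology -/
  isOpen : ∀ A ∈ T, IsOpen[limitationTopology A Y] (D A)
  /-- restrictions to closed subspaces -/
  restrict_mem : ∀ B ∈ T, ∀ A : Set B, IsClosed A → ∀ g ∈ D B, g.restrict A ∈ D (TopCat.of A)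
  /-- unions of two closed subspaces -/
  union_mem : ∀ A ∈ T, ∀ A₁ A₂ : Set A, IsClosed A₁ → IsClosed A₂ → A₁ ∪ A₂ = univ →
    ∀ g : C(A, Y), g.restrict A₁ ∈ D (TopCat.of A₁) → g.restrict A₂ ∈ D (TopCat.of A₂) → g ∈ D A
  /-- unions of discrete families of closed subspaces with discrete families of images -/
  discrete_mem : ∀ A ∈ T, ∀ (ι : Type u) (S : ι → Set A), (∀ t, IsClosed (S t)) →
    DiscreteFamily S → ⋃ t, S t = univ → ∀ g : C(A, Y),
    (∀ t, g.restrict (S t) ∈ D (TopCat.of (S t))) → DiscreteFamily (fun t => g '' S t) → g ∈ D A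

/-- The axiom of strong normality. -/
def StrongAxiom : Prop :=
  ∀ A ∈ T, ∀ B : Set A, IsClosed B → ∀ f : C(A, Y), f.restrict B ∈ D (TopCat.of B) →
    ∃ K : Set A, IsClosed K ∧ f.restrict K ∈ D (TopCat.of K) ∧ B ⊆ interior K

/-- The axiom of transitivity. -/
def TransitiveAxiom : Prop :=
  ∀ A ∈ T, ∀ B ∈ T, ∀ f : C(A, B), ∀ g ∈ D B, g.comp f ∈ D A

/-- Strongly normal systems. -/
def IsStronglyNormal : Prop := IsNormalSystem Y T D ∧ StrongAxiom Y T D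

/-- Transitive normal systems. -/
def IsTransitiveNormal : Prop := IsNormalSystem Y T D ∧ TransitiveAxiom Y T D

end Systems

/-! ### Simplicial complexes -/

/-- The two topologies on the geometric realization of a simplicial complex. -/
inductive ComplexTopology
  | weak
  | metric

section Complexes

variable {ι : Type u} (K : AbstractSimplicialComplex ι)

/-- The closed geometric simplex spanned by `σ` in the Hilbert space `ℓ²(ι)`, where `ι` is identified
with the standard orthonormal basis. -/
def simplex (σ : Finset ι) : Set (lp (fun _ : ι => ℝ) 2) :=
  {x | (∀ v, 0 ≤ x v) ∧ (∀ v ∉ σ, x v = 0) ∧ ∑ v ∈ σ, x v = 1}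

/-- The geometric realization of `K` as a subset of the Hilbert space. -/
def carrier : Set (lp (fun _ : ι => ℝ) 2) := ⋃ σ ∈ K.faces, simplex σ

/-- The geometric realization of `K`, to be equipped with the topology `τ`. -/
def Realization (_τ : ComplexTopology) : Type u := carrier K

/-- The metric topology is induced from the Hilbert space, the weak one is coherent with
the family of all closed simplices. -/
instance (τ : ComplexTopology) : TopologicalSpace (Realization K τ) :=
  match τ with
  | .metric => (instTopologicalSpaceSubtype : TopologicalSpace (carrier K))
  | .weak => ⨆ σ : K.faces, TopologicalSpace.coinduced
      (fun x : simplex σ.1 => (⟨x.1, mem_biUnion σ.2 x.2⟩ : carrier K)) inferInstance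

/-- The identity `|K|_w → |K|_m`. -/
def toMetric (x : Realization K .weak) : Realization K .metric := x

/-- The dimension of a simplicial complex; `⊥` for the empty complex. -/
def complexDim : WithBot ℕ∞ := ⨆ σ ∈ K.faces, ((σ.card - 1 : ℕ) : WithBot ℕ∞)

/-- Every vertex lies in simplices of bounded dimension only. -/
def LocallyFiniteDimensional : Prop :=
  ∀ v : ι, ∃ n : ℕ, ∀ σ ∈ K.faces, v ∈ σ → σ.card ≤ n

def FiniteDimensional : Prop := ∃ n : ℕ, ∀ σ ∈ K.faces, σ.card ≤ n

/-- Every vertex lies in finitely many simplices. -/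
def LocallyFinite : Prop := ∀ v : ι, {σ ∈ K.faces | v ∈ σ}.Finite

/-- For a map `f` from `X` into an open subset `V` of `Y` and an open cover `𝒰` of `Y`, the complex
`K` admits maps `v : X → |K|_w` and `w : |K|_m → Y` whose composition (through the identity
`|K|_w → |K|_m`) is `𝒰`-close to `f`, and `K` satisfies the listed size restrictions (its vertices
are the elements of `ι`). -/
structure Witnesses {X Y : Type u} [TopologicalSpace X] [TopologicalSpace Y] (V : Set Y)
    (f : C(X, V)) (𝒰 : Set (Set Y)) : Prop where
  approx : ∃ (v : C(X, Realization K .weak)) (w : C(Realization K .metric, Y)),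
    Close 𝒰 (fun x => (f x : Y)) (fun x => w (toMetric K (v x)))
  locallyFiniteDimensional : LocallyFiniteDimensional K
  card_lt : #ι < min (comp X) (comp (closure V))
  dim_le : complexDim K ≤ min (covDim X) (covDim V)
  finiteDimensional : FDT X ∨ FDT (closure V) → FiniteDimensional K
  locallyFinite : TopologicalSpace.SeparableSpace V → LocallyFinite K

end Complexes

/-- The complex `J_n(α)` on a set `E` of `α` vertices with a distinguished vertex `e`: its faces are
all nonempty finite `σ ⊆ E` such that `card (σ ∪ {e}) ≤ n + 1`. -/
def complexJ {E : Type u} (e : E) (n : ℕ+) : AbstractSimplicialComplex E where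
  faces := {σ | σ.Nonempty ∧ (insert e (σ : Set E)).encard ≤ (n : ℕ) + 1}
  isRelLowerSet_faces := by
    rintro σ ⟨hσ, h⟩
    exact ⟨hσ, fun t ht htn =>
      ⟨htn, (encard_le_encard (insert_subset_insert (Finset.coe_subset.2 ht))).trans h⟩⟩
  singleton_mem v := by
    refine ⟨Finset.singleton_nonempty v, ?_⟩
    refine (encard_insert_le _ _).trans ?_
    have h : (1 : ℕ∞) ≤ ((n : ℕ) : ℕ∞) := by exact_mod_cast n.2
    simpa using add_le_add_left h 1

/-- The space `J(α) = ⨁_{n ≥ 1} |J_n(α)|_τ`. -/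
abbrev SpaceJ {E : Type u} (e : E) (τ : ComplexTopology) : Type u :=
  Σ n : ℕ+, Realization (complexJ e n) τ

/-- The cube `I^n`. -/
abbrev Cube (n : ℕ) : Type := Fin n → unitInterval

/-- The class `T` is corelated to `Y` (with respect to the topology `τ` on complexes). -/
def Corelated (τ : ComplexTopology) (T : Set TopCat.{u}) (Y : Type u) [TopologicalSpace Y] : Prop :=
  (∀ X ∈ T, NormalSpace X ∧ NbhdExtensor Y X) ∧
  ∀ X ∈ T, ∃ 𝒱 : Set (Set Y), IsCov 𝒱 ∧ ∀ V ∈ 𝒱,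
    comp (closure V) ≤ compLoc Y ∧
    (LocallyFDT Y → FDT (closure V)) ∧
    ∀ (f : C(X, V)) (𝒰 : Set (Set Y)), IsCov 𝒰 →
      ∃ (ι : Type u) (K : AbstractSimplicialComplex ι), Witnesses K V f 𝒰 ∧
        ∃ Z ∈ T, Nonempty (Z ≃ₜ Realization K τ)

/-- `comp(T ∧ Y) = sup {min (comp X) (comp_l Y) | X ∈ T}` (the set is bounded by `comp_l Y`). -/
def compMeet (T : Set TopCat.{u}) (Y : Type u) [TopologicalSpace Y] : Cardinal.{u} :=
  sSup ((fun X : TopCat.{u} => min (comp X) (compLoc Y)) '' T)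

/-- `dim(T ∧ Y) = sup {min (dim X) (dim Y) | X ∈ T}`. -/
def dimMeet (T : Set TopCat.{u}) (Y : Type u) [TopologicalSpace Y] : WithBot ℕ∞ :=
  sSup ((fun X : TopCat.{u} => min (covDim X) (covDim Y)) '' T)

/-- `P ∈ T` and `D_P` has SMAP, for a space `P` which is given up to homeomorphism. For transitive
systems the choice of the homeomorphic copy of `P` in `T` is immaterial. -/
def HasSMAPAt {Y : Type u} [TopologicalSpace Y] (T : Set TopCat.{u})
    (D : ∀ X : TopCat.{u}, Set C(X, Y)) (P : Type*) [TopologicalSpace P] : Prop :=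
  ∃ Z ∈ T, Nonempty (Z ≃ₜ P) ∧ SMAP (D Z)

end

end NormalSystems

open NormalSystems

/-! # Density of transitive normal systems

Throughout, a map is approximated by members of the system up to an arbitrary open cover of `Y`.

*Extension in ANRs.* By Wojdysławski's theorem `Y` is a retract of an open subset of a convex set.
Sufficiently close maps can therefore be joined by controlled homotopies, and a map on a closed
subset which is close there to a given map extends to a map close to the given one
(`IsANR.exists_extension`). Hence approximating the restriction of `f` to a closed subset `A` is the
same as approximating `f` by maps whose restrictions to `A` belong to the system. As the sets `D A`
are open, approximations on two closed subsets can be carried out one after the other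
(`approxOn_union`).

*From small maps to all maps.* Consider the open sets `G ⊆ Y` such that maps can be approximated on
every closed set the closure of whose image lies in `G`. This property of `G` is inherited by finite
unions, by disjoint unions (this is what the axiom on discrete families is for), and by the union of
an increasing sequence exhausting `Y`. By the construction in Stone's theorem on paracompactness, it holds for
`Y` as soon as it holds for the members of an open cover (`approxOn_of_local`). Together with the
extension of small maps this shows that, if `D P` has SMAP, then all maps on all closed
subspaces of `P` can be approximated (`approx_of_smap`).

*Reduction to model spaces.* By transitivity, a map can be approximated if it factors, up to a small
error, through a space all maps of which can be approximated. Corelatedness provides factorizations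
through polyhedra `|K|` (`approx_of_corelated`), with the bounds on `K` that follow from those on
`X` and `Y`; it is used here that open subspaces of metrizable spaces do not have larger dimension.
It remains to decompose the polyhedra.

* If `K` is finite, then `|K|` is a finite union of simplices, which are retracts of cubes
  (`approx_of_finite`).
* If `K` is finite dimensional and the system is strongly normal, one proceeds by induction over the
  skeleta: outside of a neighbourhood of the `k`-skeleton, the `(k+1)`-skeleton is a discrete union
  of closed subsets of simplices, and so factors through a product of a cube and a discrete space
  (`approx_of_finiteDimensional`).
* If `K` is locally finite dimensional, a continuous function bounding the local dimension from
  above decomposes `|K|` into even and odd shells. The shells of one parity form a disjoint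
  union of closed subsets of skeleta of `K`, and such a union factors through `J(α)`
  (`approx_of_locallyFiniteDimensional`).
* A map with Lindelöf image factors, up to a small error, through the nerve of a countable cover.
  This nerve is spread out along a half-line, so that again the even and the odd shells are closed
  subspaces of the disjoint union of all cubes (`IsANR.exists_factor_telescope`,
  `approx_of_isLindelof`). The polyhedra provided by corelatedness are not needed in this case.
-/

universe w

namespace NormalSystems

/-! ### Open covers and closeness of maps -/

section Close

variable {X Y : Type*} {𝒰 𝒱 : Set (Set Y)} {f g : X → Y}

theorem Close.comp {W : Type*} (hfg : Close 𝒰 f g) (k : W → X) :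
    Close 𝒰 (fun x => f (k x)) (fun x => g (k x)) := fun x => hfg (k x)

theorem Close.inter (hfg : Close (image2 (· ∩ ·) 𝒰 𝒱) f g) : Close 𝒰 f g ∧ Close 𝒱 f g := by
  constructor <;> intro x <;> obtain ⟨_, ⟨U, hU, V, hV, rfl⟩, h1, h2⟩ := hfg x
  · exact ⟨U, hU, h1.1, h2.1⟩
  · exact ⟨V, hV, h1.2, h2.2⟩

/-- For a closed set `F` with an open neighbourhood `G`, closeness with respect to the cover
`{G, Fᶜ}` keeps the points sent by `f` into `F` from leaving `G`. -/
theorem Close.mem_of_mem {F G : Set Y} (hfg : Close {G, Fᶜ} f g) {x : X} (hx : f x ∈ F) :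
    g x ∈ G := by
  obtain ⟨U, hU, h1, h2⟩ := hfg x
  rcases hU with rfl | rfl
  · exact h2
  · exact absurd hx h1

end Close

section Covers

variable {Y : Type*} [TopologicalSpace Y]

theorem IsCov.exists_mem {𝒰 : Set (Set Y)} (h : IsCov 𝒰) (y : Y) : ∃ U ∈ 𝒰, y ∈ U := by
  have : y ∈ ⋃₀ 𝒰 := h.2 ▸ mem_univ y
  simpa using this

theorem isCov_of_forall_mem {𝒰 : Set (Set Y)} (ho : ∀ U ∈ 𝒰, IsOpen U)
    (h : ∀ y, ∃ U ∈ 𝒰, y ∈ U) : IsCov 𝒰 :=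
  ⟨ho, eq_univ_of_forall fun y => by simpa using h y⟩

/-- Barycentric refinements: all members of `𝒱` through a given point lie in one member of `𝒰`.
The radius function `R` below is a Lebesgue function of the cover; it is `1`-Lipschitz. -/
theorem IsCov.exists_barycentric [TopologicalSpace.MetrizableSpace Y] {𝒰 : Set (Set Y)}
    (h : IsCov 𝒰) : ∃ 𝒱 : Set (Set Y), IsCov 𝒱 ∧ ∀ y, ∃ U ∈ 𝒰, ∀ V ∈ 𝒱, y ∈ V → V ⊆ U := by
  let := TopologicalSpace.metrizableSpaceMetric Y
  let S : Y → Set ℝ := fun y => {δ | δ ≤ 1 ∧ ∃ U ∈ 𝒰, Metric.ball y δ ⊆ U}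
  have hbdd : ∀ y, BddAbove (S y) := fun y => ⟨1, fun δ hδ => hδ.1⟩
  let R : Y → ℝ := fun y => sSup (S y)
  have hpos : ∀ y, 0 < R y := by
    intro y
    obtain ⟨U, hU, hyU⟩ := h.exists_mem y
    obtain ⟨δ, hδ, hb⟩ := Metric.isOpen_iff.1 (h.1 U hU) y hyU
    have hm : min δ 1 ∈ S y :=
      ⟨min_le_right _ _, U, hU, (Metric.ball_subset_ball (min_le_left _ _)).trans hb⟩
    exact (lt_min hδ one_pos).trans_le (le_csSup (hbdd y) hm)
  have hball : ∀ y, ∀ δ < R y, ∃ U ∈ 𝒰, Metric.ball y δ ⊆ U := by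
    intro y δ hδ
    have hne : (S y).Nonempty := by
      by_contra hne
      have := hpos y
      simp only [R, not_nonempty_iff_eq_empty.1 hne, Real.sSup_empty, lt_irrefl] at this
    obtain ⟨δ', ⟨-, U, hU, hb⟩, hlt⟩ := exists_lt_of_lt_csSup hne hδ
    exact ⟨U, hU, (Metric.ball_subset_ball hlt.le).trans hb⟩
  have hlip : ∀ x y, R y ≤ R x + dist x y := by
    intro x y
    by_contra! hlt
    obtain ⟨δ, h1, h2⟩ := exists_between hlt
    have hδ1 : δ ≤ 1 := h2.le.trans (Real.sSup_le (fun δ hδ => hδ.1) zero_le_one)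
    obtain ⟨U, hU, hb⟩ := hball y δ h2
    have hm : δ - dist x y ∈ S x :=
      ⟨by linarith [dist_nonneg (x := x) (y := y)], U, hU,
        (Metric.ball_subset_ball' (by linarith)).trans hb⟩
    linarith [le_csSup (hbdd x) hm]
  refine ⟨range fun y => Metric.ball y (R y / 4), isCov_of_forall_mem ?_ ?_, fun x => ?_⟩
  · rintro _ ⟨y, rfl⟩
    exact Metric.isOpen_ball
  · exact fun y => ⟨_, ⟨y, rfl⟩, Metric.mem_ball_self (by linarith [hpos y])⟩
  · obtain ⟨U, hU, hb⟩ := hball x (3 / 4 * R x) (by linarith [hpos x])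
    refine ⟨U, hU, ?_⟩
    rintro _ ⟨y, rfl⟩ hxy
    refine Subset.trans (Metric.ball_subset_ball' ?_) hb
    have h1 : dist x y < R y / 4 := hxy
    have h2 := hlip x y
    rw [dist_comm]
    linarith [hpos y]

variable {X : Type*} {𝒰 𝒱 : Set (Set Y)} {f g : X → Y}

theorem IsCov.close_refl (h𝒰 : IsCov 𝒰) (f : X → Y) : Close 𝒰 f f := fun x =>
  let ⟨U, hU, h1⟩ := h𝒰.exists_mem (f x)
  ⟨U, hU, h1, h1⟩

theorem isCov_univ : IsCov {(univ : Set Y)} :=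
  isCov_of_forall_mem (by simp) (by simp)

theorem isCov_pair {F G : Set Y} (hF : IsClosed F) (hG : IsOpen G) (hFG : F ⊆ G) :
    IsCov {G, Fᶜ} := by
  refine isCov_of_forall_mem ?_ fun y => ?_
  · rintro U (rfl | rfl)
    exacts [hG, hF.isOpen_compl]
  · by_cases hy : y ∈ F
    exacts [⟨G, by simp, hFG hy⟩, ⟨Fᶜ, by simp, hy⟩]

/-- Every open cover has a refinement such that two successive steps of closeness with respect to
the refinement amount to closeness with respect to the given cover. -/
theorem IsCov.exists_half [TopologicalSpace.MetrizableSpace Y] (h𝒰 : IsCov 𝒰) :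
    ∃ 𝒱 : Set (Set Y), IsCov 𝒱 ∧ ∀ {X : Type u} {f g h : X → Y},
      Close 𝒱 f g → Close 𝒱 g h → Close 𝒰 f h := by
  obtain ⟨𝒱, h𝒱, hst⟩ := h𝒰.exists_barycentric
  refine ⟨𝒱, h𝒱, fun {X f g h} hfg hgh x => ?_⟩
  obtain ⟨U, hU, hst⟩ := hst (g x)
  obtain ⟨V, hV, h1, h2⟩ := hfg x
  obtain ⟨W, hW, h3, h4⟩ := hgh x
  exact ⟨U, hU, hst V hV h2 h1, hst W hW h3 h4⟩

/-- For metrizable `Y` the sets `B(f, 𝒰)` are neighbourhoods of `f` in the limitation topology, so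
members of a closure can be approximated. -/
theorem exists_close_of_mem_closure {X : Type u} [TopologicalSpace X]
    [TopologicalSpace.MetrizableSpace Y] {D : Set C(X, Y)} {f : C(X, Y)}
    (hf : f ∈ closure[limitationTopology X Y] D) (h𝒰 : IsCov 𝒰) : ∃ g ∈ D, Close 𝒰 f g := by
  let := limitationTopology X Y
  have hopen : IsOpen {g : C(X, Y) | ∃ 𝒱, IsCov 𝒱 ∧ coverBall g 𝒱 ⊆ coverBall f 𝒰} := by
    rintro g ⟨𝒱, h𝒱, hg⟩
    obtain ⟨𝒲, h𝒲, htr⟩ := h𝒱.exists_half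
    exact ⟨𝒲, h𝒲, fun h hgh => ⟨𝒲, h𝒲, fun k hhk => hg (htr hgh hhk)⟩⟩
  obtain ⟨g, ⟨𝒱, h𝒱, hg⟩, hgD⟩ := mem_closure_iff.1 hf _ hopen ⟨𝒰, h𝒰, Subset.rfl⟩
  exact ⟨g, hgD, hg (h𝒱.close_refl g)⟩

end Covers

/-! ### Consequences of the ANR property -/

section ANR

variable {Y : Type u} [TopologicalSpace Y]

/-- **Wojdysławski's theorem**: a metrizable space embeds as a closed subset of a convex subset of a
normed space. The Kuratowski embedding `y ↦ min 1 (dist · y)` into the space of bounded continuous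
functions has closed image in the convex hull of its image. -/
theorem exists_isClosedEmbedding_convexHull (Y : Type u) [TopologicalSpace Y]
    [TopologicalSpace.MetrizableSpace Y] :
    ∃ (E : Type u) (_ : NormedAddCommGroup E) (_ : NormedSpace ℝ E) (k : Y → E),
      IsClosedEmbedding fun y =>
        (⟨k y, subset_convexHull ℝ _ (mem_range_self y)⟩ : convexHull ℝ (range k)) := by
  let := TopologicalSpace.metrizableSpaceMetric Y
  let k : Y → BoundedContinuousFunction Y ℝ := fun y =>
    BoundedContinuousFunction.ofNormedAddCommGroup
      (fun x => min 1 (dist x y)) (by fun_prop) 1 fun x => by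
        rw [Real.norm_eq_abs, abs_of_nonneg (by positivity)]
        exact min_le_left _ _
  refine ⟨BoundedContinuousFunction Y ℝ, inferInstance, inferInstance, k, ?_⟩
  have hk : ∀ x y, k y x = min 1 (dist x y) := fun x y => rfl
  have hkd : ∀ y z, dist (k y) (k z) ≤ dist y z := by
    intro y z
    refine (BoundedContinuousFunction.dist_le dist_nonneg).2 fun x => ?_
    rw [hk, hk, Real.dist_eq]
    refine (abs_min_sub_min_le_max 1 (dist x y) 1 (dist x z)).trans ?_
    simp only [sub_self, abs_zero]
    exact max_le dist_nonneg (by rw [← Real.dist_eq]; exact dist_dist_dist_le_right x y z)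
  have hkc : Continuous k := (LipschitzWith.mk_one hkd).continuous
  have hkl : ∀ y z, min 1 (dist y z) ≤ dist (k y) (k z) := by
    intro y z
    have h := BoundedContinuousFunction.dist_coe_le_dist (f := k y) (g := k z) y
    rw [hk, hk, dist_self, Real.dist_eq, abs_sub_comm] at h
    refine le_trans ?_ h
    simp [abs_of_nonneg]
  have hemb : IsEmbedding k := by
    refine ⟨⟨?_⟩, fun y z hyz => ?_⟩
    · refine le_antisymm (continuous_iff_le_induced.1 hkc) ?_
      rw [le_iff_nhds]
      intro y
      rw [nhds_induced, Metric.nhds_basis_ball.ge_iff]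
      intro ε hε
      refine ⟨Metric.ball (k y) (min 1 ε), Metric.ball_mem_nhds _ (by positivity), fun z hz => ?_⟩
      have h1 := (hkl z y).trans_lt hz
      rw [Metric.mem_ball]
      by_contra! hlt
      exact absurd h1 (not_lt.2 (min_le_min le_rfl hlt))
    · have h := hkl y z
      rw [hyz, dist_self] at h
      by_contra hne
      exact absurd h (not_le.2 (lt_min one_pos (dist_pos.2 hne)))
  -- Every member of the hull dominates a positive multiple of some `k y₀`.
  have hdom : ∀ z ∈ convexHull ℝ (range k),
      ∃ (y₀ : Y) (c : ℝ), 0 < c ∧ ∀ y, c * min 1 (dist y y₀) ≤ z y := by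
    have hconv : Convex ℝ {z : BoundedContinuousFunction Y ℝ |
        ∃ (y₀ : Y) (c : ℝ), 0 < c ∧ ∀ y, c * min 1 (dist y y₀) ≤ z y} := by
      rintro z₁ ⟨y₁, c₁, hc₁, h₁⟩ z₂ ⟨y₂, c₂, hc₂, h₂⟩ a b ha hb hab
      have hn : ∀ (w x : Y), 0 ≤ min 1 (dist w x) := fun w x => by positivity
      have hp₁ : ∀ y, 0 ≤ z₁ y := fun y => (mul_nonneg hc₁.le (hn _ _)).trans (h₁ y)
      have hp₂ : ∀ y, 0 ≤ z₂ y := fun y => (mul_nonneg hc₂.le (hn _ _)).trans (h₂ y)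
      rcases ha.eq_or_lt with rfl | ha
      · obtain rfl : b = 1 := by linarith
        simpa using ⟨y₂, c₂, hc₂, h₂⟩
      · refine ⟨y₁, a * c₁, by positivity, fun y => ?_⟩
        have e : (a • z₁ + b • z₂) y = a * z₁ y + b * z₂ y := rfl
        rw [e, mul_assoc]
        exact le_add_of_le_of_nonneg (mul_le_mul_of_nonneg_left (h₁ y) ha.le)
          (mul_nonneg hb (hp₂ y))
    refine fun z hz => convexHull_min ?_ hconv hz
    rintro _ ⟨y₀, rfl⟩
    exact ⟨y₀, 1, one_pos, fun y => by rw [hk, one_mul]⟩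
  refine ⟨IsEmbedding.of_comp (by fun_prop) continuous_subtype_val hemb, ?_⟩
  refine isClosed_of_closure_subset fun z hz => ?_
  obtain ⟨y₀, c, hc, hdz⟩ := hdom z.1 z.2
  refine ⟨y₀, Subtype.ext ?_⟩
  change k y₀ = z.1
  rw [← dist_le_zero]
  refine le_of_forall_pos_le_add fun ε hε => ?_
  obtain ⟨_, ⟨y, rfl⟩, hy⟩ := Metric.mem_closure_iff.1 hz (min (ε / 2) (c * min 1 (ε / 2)))
    (by positivity)
  have h1 : dist z.1 (k y) < min (ε / 2) (c * min 1 (ε / 2)) := hy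
  have h2 : z.1 y ≤ dist z.1 (k y) := by
    have h := BoundedContinuousFunction.dist_coe_le_dist (f := z.1) (g := k y) y
    rw [hk, dist_self, Real.dist_eq, min_eq_right zero_le_one, sub_zero] at h
    exact (le_abs_self _).trans h
  have h3 : c * min 1 (dist y y₀) < c * min 1 (ε / 2) :=
    ((hdz y).trans h2).trans_lt (h1.trans_le (min_le_right _ _))
  have h4 : dist y y₀ < ε / 2 := by
    by_contra! hge
    exact absurd h3 (not_lt.2 (mul_le_mul_of_nonneg_left (min_le_min le_rfl hge) hc.le))
  have h5 : dist (k y₀) z.1 ≤ dist (k y₀) (k y) + dist z.1 (k y) := dist_triangle_right _ _ _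
  have h6 := hkd y₀ y
  rw [dist_comm y₀ y] at h6
  linarith [h1.trans_le (min_le_left _ _)]

/-- A nonempty ANR is a retract of a relatively open subset `O` of the convex hull of its image
under an embedding `k` into a normed space. -/
theorem IsANR.exists_retraction (hY : IsANR Y) [Nonempty Y] :
    ∃ (E : Type u) (_ : NormedAddCommGroup E) (_ : NormedSpace ℝ E) (k : Y → E) (r : E → Y)
      (O : Set E), Continuous k ∧ ContinuousOn r O ∧ (∀ y, r (k y) = y) ∧
      ∀ y, ∀ U ∈ 𝓝 y, ∃ δ > 0,
        Metric.ball (k y) δ ∩ convexHull ℝ (range k) ⊆ O ∩ r ⁻¹' U := by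
  have := hY.1
  obtain ⟨E, hE, hE', k, hi⟩ := exists_isClosedEmbedding_convexHull Y
  have hkc : Continuous k := continuous_subtype_val.comp hi.continuous
  set H : Set E := convexHull ℝ (range k)
  set i : Y → H := fun y => ⟨k y, subset_convexHull ℝ _ (mem_range_self y)⟩
  obtain ⟨U, hU, hiU, ρ, hρ⟩ := hY.2 H i hi
  have hinj : Function.Injective (fun u : U => ((u : H) : E)) := fun a b hab =>
    Subtype.ext (Subtype.ext hab)
  let r : E → Y := Function.extend (fun u : U => ((u : H) : E)) ρ fun _ => Classical.arbitrary Y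
  have hr : ∀ u : U, r ((u : H) : E) = ρ u := fun u => hinj.extend_apply _ _ u
  refine ⟨E, hE, hE', k, r, (↑) '' U, hkc, ?_, fun y => ?_, fun y V hV => ?_⟩
  · have hemb' : IsEmbedding (fun u : U => ((u : H) : E)) :=
      IsEmbedding.subtypeVal.comp IsEmbedding.subtypeVal
    rintro _ ⟨z, hz, rfl⟩
    have h1 : 𝓝[(↑) '' U] (z : E) = Filter.map (fun u : U => ((u : H) : E)) (𝓝 ⟨z, hz⟩) := by
      rw [hemb'.map_nhds_eq]
      congr 1
      ext w
      simp
    rw [ContinuousWithinAt, h1, Filter.tendsto_map'_iff]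
    have h2 : r ∘ (fun u : U => ((u : H) : E)) = ρ := funext hr
    rw [h2, hr ⟨z, hz⟩]
    exact ρ.continuous.tendsto _
  · exact (hr ⟨i y, hiU (mem_range_self y)⟩).trans (hρ y)
  · have h1 : (↑) '' (ρ ⁻¹' V) ∈ 𝓝 (i y) := by
      have : (i y) = ((⟨i y, hiU (mem_range_self y)⟩ : U) : H) := rfl
      rw [this]
      refine hU.isOpenEmbedding_subtypeVal.image_mem_nhds.2 ?_
      exact ρ.continuous.continuousAt.preimage_mem_nhds (by rwa [hρ])
    obtain ⟨δ, hδ, hb⟩ := Metric.mem_nhds_iff.1 h1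
    refine ⟨δ, hδ, ?_⟩
    rintro z ⟨hz, hzH⟩
    obtain ⟨u, hu, huz⟩ := hb (show (⟨z, hzH⟩ : H) ∈ Metric.ball (i y) δ from hz)
    have hzu : z = ((u : H) : E) := by rw [huz]
    refine ⟨⟨u, u.2, hzu.symm⟩, ?_⟩
    rw [mem_preimage, hzu, hr]
    exact hu

/-- A retraction as in `IsANR.exists_retraction`, together with the fact that a sufficiently fine
open cover has members whose convex hulls are mapped into members of a given cover. -/
theorem IsANR.exists_convex_retraction (hY : IsANR Y) [Nonempty Y] :
    ∃ (E : Type u) (_ : NormedAddCommGroup E) (_ : NormedSpace ℝ E) (k : Y → E) (r : E → Y)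
      (O : Set E), Continuous k ∧ ContinuousOn r O ∧ (∀ y, r (k y) = y) ∧
      ∀ 𝒰 : Set (Set Y), IsCov 𝒰 → ∃ 𝒱 : Set (Set Y), IsCov 𝒱 ∧
        ∀ V ∈ 𝒱, ∃ U ∈ 𝒰, convexHull ℝ (k '' V) ⊆ O ∩ r ⁻¹' U := by
  obtain ⟨E, hE, hE', k, r, O, hk, hr, hrk, hδ⟩ := hY.exists_retraction
  refine ⟨E, hE, hE', k, r, O, hk, hr, hrk, fun 𝒰 h𝒰 => ?_⟩
  have h : ∀ y, ∃ δ > 0, ∃ U ∈ 𝒰, Metric.ball (k y) δ ∩ convexHull ℝ (range k) ⊆ O ∩ r ⁻¹' U := by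
    intro y
    obtain ⟨U, hU, hyU⟩ := h𝒰.exists_mem y
    obtain ⟨δ, h1, h2⟩ := hδ y U ((h𝒰.1 U hU).mem_nhds hyU)
    exact ⟨δ, h1, U, hU, h2⟩
  choose δ hδ0 U hU hb using h
  refine ⟨range fun y => k ⁻¹' Metric.ball (k y) (δ y), isCov_of_forall_mem ?_ ?_, ?_⟩
  · rintro _ ⟨y, rfl⟩
    exact Metric.isOpen_ball.preimage hk
  · exact fun y => ⟨_, ⟨y, rfl⟩, Metric.mem_ball_self (hδ0 y)⟩
  · rintro _ ⟨y, rfl⟩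
    refine ⟨U y, hU y, Subset.trans (subset_inter ?_ ?_) (hb y)⟩
    · exact convexHull_min (image_preimage_subset _ _) (convex_ball _ _)
    · exact convexHull_mono (image_subset_range _ _)

/-- Controlled extension: a map defined on a closed subset and close there to a map `f` defined on
the whole space extends to a map close to `f`. The extension follows the segments from `f` to
an extension over a neighbourhood, with a Urysohn function as parameter. -/
theorem IsANR.exists_extension (hY : IsANR Y) {𝒰 : Set (Set Y)} (h𝒰 : IsCov 𝒰) :
    ∃ 𝒱 : Set (Set Y), IsCov 𝒱 ∧ ∀ {X : Type u} [TopologicalSpace X] [NormalSpace X],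
      NbhdExtensor Y X → ∀ {A : Set X}, IsClosed A → ∀ (f : C(X, Y)) (g : C(A, Y)),
        Close 𝒱 (fun a : A => f a) g → ∃ g' : C(X, Y), g'.restrict A = g ∧ Close 𝒰 f g' := by
  rcases isEmpty_or_nonempty Y with hE | hne
  · refine ⟨𝒰, h𝒰, fun {X} _ _ _ A _ f g _ => ⟨f, ?_, fun x => isEmptyElim (f x)⟩⟩
    ext a
    exact isEmptyElim (f a)
  obtain ⟨E, _, _, k, r, O, hk, hr, hrk, hcov⟩ := hY.exists_convex_retraction
  obtain ⟨𝒱, h𝒱, hV⟩ := hcov 𝒰 h𝒰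
  refine ⟨𝒱, h𝒱, fun {X} _ _ hX A hA f g hfg => ?_⟩
  obtain ⟨U₀, hU₀, hAU, g₀, hg₀⟩ := hX A hA g
  let G : X → Y := Function.extend (Subtype.val : U₀ → X) g₀ f
  have hG : ∀ x : U₀, G x = g₀ x := fun x => Subtype.val_injective.extend_apply _ _ x
  have hGc : ContinuousOn G U₀ := by
    rw [continuousOn_iff_continuous_domRestrict]
    have : U₀.domRestrict G = g₀ := funext hG
    rw [this]
    exact g₀.continuous
  have hGA : ∀ a : A, G a = g a := fun a => (hG ⟨a, hAU a.2⟩).trans (hg₀ a)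
  let W : Set X := U₀ ∩ ⋃ V ∈ 𝒱, f ⁻¹' V ∩ (U₀ ∩ G ⁻¹' V)
  have hW : IsOpen W := hU₀.inter <| isOpen_biUnion fun V hV' =>
    ((h𝒱.1 V hV').preimage f.continuous).inter (hGc.isOpen_inter_preimage hU₀ (h𝒱.1 V hV'))
  have hWc : ∀ x ∈ W, ∃ V ∈ 𝒱, f x ∈ V ∧ G x ∈ V := by
    rintro x ⟨-, hx⟩
    simp only [mem_iUnion] at hx
    obtain ⟨V, hV', h1, -, h2⟩ := hx
    exact ⟨V, hV', h1, h2⟩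
  have hAW : A ⊆ W := by
    intro a ha
    obtain ⟨V, hV', h1, h2⟩ := hfg ⟨a, ha⟩
    refine ⟨hAU ha, mem_biUnion hV' ⟨h1, hAU ha, ?_⟩⟩
    rw [mem_preimage, hGA ⟨a, ha⟩]
    exact h2
  obtain ⟨W₁, hW₁, hAW₁, hW₁W⟩ := normal_exists_closure_subset hA hW hAW
  obtain ⟨u, hu0, hu1, hu⟩ := exists_continuous_zero_one_of_isClosed hW₁.isClosed_compl hA
    (disjoint_left.2 fun x hx hxA => hx (hAW₁ hxA))
  let Φ : X → E := fun x => (1 - u x) • k (f x) + u x • k (G x)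
  have hΦ : ∀ V, ∀ x, f x ∈ V → G x ∈ V → Φ x ∈ convexHull ℝ (k '' V) := fun V x h1 h2 =>
    convex_convexHull ℝ _ (subset_convexHull ℝ _ (mem_image_of_mem k h1))
      (subset_convexHull ℝ _ (mem_image_of_mem k h2)) (by linarith [(hu x).2]) (hu x).1 (by ring)
  have hout : ∀ x ∉ closure W₁, Φ x = k (f x) := by
    intro x hx
    have : u x = 0 := hu0 fun h => hx (subset_closure h)
    simp [Φ, this]
  have hcont : Continuous fun x => r (Φ x) := by
    rw [continuous_iff_continuousAt]
    intro x
    by_cases hx : x ∈ W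
    · have hcW : ContinuousOn Φ W :=
        ((continuousOn_const.sub u.continuous.continuousOn).smul
          (hk.comp f.continuous).continuousOn).add
          (u.continuous.continuousOn.smul (hk.comp_continuousOn (hGc.mono inter_subset_left)))
      refine (hr.comp hcW fun x hx => ?_).continuousAt (hW.mem_nhds hx)
      obtain ⟨V, hV', h1, h2⟩ := hWc x hx
      obtain ⟨U, -, hU⟩ := hV V hV'
      exact (hU (hΦ V x h1 h2)).1
    · have hx' : x ∈ (closure W₁)ᶜ := fun h => hx (hW₁W h)
      refine f.continuous.continuousAt.congr ?_
      filter_upwards [isClosed_closure.isOpen_compl.mem_nhds hx'] with z hz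
      rw [hout z hz, hrk]
  refine ⟨⟨_, hcont⟩, ?_, fun x => ?_⟩
  · ext a
    have h1 : u a = 1 := hu1 a.2
    change r (Φ a) = g a
    simp [Φ, h1, hrk, hGA]
  · change ∃ U ∈ 𝒰, f x ∈ U ∧ r (Φ x) ∈ U
    by_cases hx : x ∈ W
    · obtain ⟨V, hV', h1, h2⟩ := hWc x hx
      obtain ⟨U, hU', hU⟩ := hV V hV'
      refine ⟨U, hU', ?_, (hU (hΦ V x h1 h2)).2⟩
      have := (hU (subset_convexHull ℝ _ (mem_image_of_mem k h1))).2
      rwa [mem_preimage, hrk] at this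
    · rw [hout x fun h => hx (hW₁W h), hrk]
      obtain ⟨U, hU', h⟩ := h𝒰.exists_mem (f x)
      exact ⟨U, hU', h, h⟩

end ANR

/-! ### Approximation by members of a normal system -/

section Systems

variable {Y : Type u} [TopologicalSpace Y]

/-- The map `f` is a limit of members of `D X`. -/
def Approx (D : ∀ X : TopCat.{u}, Set C(X, Y)) {X : Type u} [TopologicalSpace X] (f : C(X, Y)) :
    Prop :=
  ∀ 𝒰 : Set (Set Y), IsCov 𝒰 → ∃ g ∈ D (TopCat.of X), Close 𝒰 f g

/-- The map `f` is a limit of maps defined on the same space whose restrictions to `A` belong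
to the system. -/
def ApproxOn (D : ∀ X : TopCat.{u}, Set C(X, Y)) {X : Type u} [TopologicalSpace X] (f : C(X, Y))
    (A : Set X) : Prop :=
  ∀ 𝒰 : Set (Set Y), IsCov 𝒰 → ∃ g : C(X, Y), Close 𝒰 f g ∧ g.restrict A ∈ D (TopCat.of A)

/-- The standing assumptions: `Y` is an ANR which is a neighbourhood extensor for the normal spaces
in the closed hereditary class `T`, and `D` is a transitive normal system. -/
structure IsSetting (T : Set TopCat.{u}) (D : ∀ X : TopCat.{u}, Set C(X, Y)) : Prop where
  isANR : IsANR Y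
  closedHereditary : ClosedHereditary T
  normalSpace : ∀ {X : Type u} [TopologicalSpace X], TopCat.of X ∈ T → NormalSpace X
  nbhdExtensor : ∀ {X : Type u} [TopologicalSpace X], TopCat.of X ∈ T → NbhdExtensor Y X
  isNormalSystem : IsNormalSystem Y T D
  transitive : TransitiveAxiom Y T D

variable {T : Set TopCat.{u}} {D : ∀ X : TopCat.{u}, Set C(X, Y)}

namespace IsSetting

variable (h : IsSetting T D) {X P Q : Type u} [TopologicalSpace X] [TopologicalSpace P]
  [TopologicalSpace Q]

include h

theorem of_isClosed (hX : TopCat.of X ∈ T) {A : Set X} (hA : IsClosed A) : TopCat.of A ∈ T :=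
  h.closedHereditary _ hX A hA

theorem comp_mem (hX : TopCat.of X ∈ T) (hP : TopCat.of P ∈ T) (φ : C(X, P)) {g : C(P, Y)}
    (hg : g ∈ D (TopCat.of P)) : g.comp φ ∈ D (TopCat.of X) :=
  h.transitive _ hX _ hP φ g hg

theorem restrict_mono (hX : TopCat.of X ∈ T) {A B : Set X} (hA : IsClosed A) (hB : IsClosed B)
    (hAB : A ⊆ B) {g : C(X, Y)} (hg : g.restrict B ∈ D (TopCat.of B)) :
    g.restrict A ∈ D (TopCat.of A) :=
  h.comp_mem (h.of_isClosed hX hA) (h.of_isClosed hX hB)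
    ⟨inclusion hAB, continuous_inclusion hAB⟩ hg

theorem mem_of_isEmpty (hX : TopCat.of X ∈ T) [IsEmpty X] (g : C(X, Y)) :
    g ∈ D (TopCat.of X) := by
  refine h.isNormalSystem.discrete_mem (TopCat.of X) hX PEmpty (fun t => t.elim) (fun t => t.elim)
    (fun x => isEmptyElim (α := X) x) (Subsingleton.elim (α := Set X) _ _) g (fun t => t.elim)
    fun y => ⟨univ, Filter.univ_mem, fun s => s.elim⟩

theorem restrict_univ (hX : TopCat.of X ∈ T) {g : C(X, Y)}
    (hg : g.restrict univ ∈ D (TopCat.of (univ : Set X))) : g ∈ D (TopCat.of X) :=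
  h.comp_mem (g := g.restrict univ) hX (h.of_isClosed hX isClosed_univ)
    ⟨fun x => ⟨x, mem_univ x⟩, by fun_prop⟩ hg

theorem restrict_union (hX : TopCat.of X ∈ T) {A B : Set X} (hA : IsClosed A) (hB : IsClosed B)
    {g : C(X, Y)} (hgA : g.restrict A ∈ D (TopCat.of A)) (hgB : g.restrict B ∈ D (TopCat.of B)) :
    g.restrict (A ∪ B) ∈ D (TopCat.of (A ∪ B : Set X)) := by
  have hAB := h.of_isClosed hX (hA.union hB)
  have hA' : IsClosed ((↑) ⁻¹' A : Set (A ∪ B : Set X)) := hA.preimage continuous_subtype_val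
  have hB' : IsClosed ((↑) ⁻¹' B : Set (A ∪ B : Set X)) := hB.preimage continuous_subtype_val
  refine h.isNormalSystem.union_mem _ hAB (Subtype.val ⁻¹' A) (Subtype.val ⁻¹' B) hA' hB'
    (eq_univ_of_forall fun x => x.2) _ ?_ ?_
  · exact h.comp_mem (h.of_isClosed hAB hA') (h.of_isClosed hX hA)
      ⟨fun x => ⟨x.1.1, x.2⟩, by fun_prop⟩ hgA
  · exact h.comp_mem (h.of_isClosed hAB hB') (h.of_isClosed hX hB)
      ⟨fun x => ⟨x.1.1, x.2⟩, by fun_prop⟩ hgB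

/-- Openness of the system, in terms of covers. -/
theorem exists_cov_of_mem (hX : TopCat.of X ∈ T) {g : C(X, Y)}
    (hg : g ∈ D (TopCat.of X)) : ∃ 𝒲 : Set (Set Y), IsCov 𝒲 ∧
      ∀ g' : C(X, Y), Close 𝒲 g g' → g' ∈ D (TopCat.of X) := by
  obtain ⟨𝒲, h𝒲, hsub⟩ := h.isNormalSystem.isOpen _ hX g hg
  exact ⟨𝒲, h𝒲, fun g' hg' => hsub hg'⟩

/-- A map on a closed subset which approximates the restriction of `f` and belongs to the system
extends, by controlled extension, to an approximation of `f`. -/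
theorem approxOn_of_restrict (hX : TopCat.of X ∈ T) {A : Set X} (hA : IsClosed A) {f : C(X, Y)}
    (hf : Approx D (f.restrict A)) : ApproxOn D f A := by
  intro 𝒰 h𝒰
  obtain ⟨𝒱, h𝒱, hext⟩ := h.isANR.exists_extension h𝒰
  obtain ⟨g, hg, hfg⟩ := hf 𝒱 h𝒱
  have := h.normalSpace hX
  obtain ⟨g', hg', hfg'⟩ := hext (h.nbhdExtensor hX) hA f g hfg
  exact ⟨g', hfg', hg' ▸ hg⟩

theorem approx_of_approxOn_univ (hX : TopCat.of X ∈ T) {f : C(X, Y)} (hf : ApproxOn D f univ) :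
    Approx D f := fun 𝒰 h𝒰 =>
  let ⟨g, hfg, hg⟩ := hf 𝒰 h𝒰
  ⟨g, h.restrict_univ hX hg, hfg⟩

theorem approxOn_mono (hX : TopCat.of X ∈ T) {A B : Set X} (hA : IsClosed A) (hB : IsClosed B)
    (hAB : A ⊆ B) {f : C(X, Y)} (hf : ApproxOn D f B) : ApproxOn D f A := fun 𝒰 h𝒰 =>
  let ⟨g, hfg, hg⟩ := hf 𝒰 h𝒰
  ⟨g, hfg, h.restrict_mono hX hA hB hAB hg⟩

/-- Members of the system on `A` form an open set, so an approximation on `A` survives a further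
approximation on `B`. The latter is needed only for maps sufficiently close to `f`. -/
theorem approxOn_union (hX : TopCat.of X ∈ T) {A B : Set X} (hA : IsClosed A) (hB : IsClosed B)
    {f : C(X, Y)} (hfA : ApproxOn D f A) {𝒲 : Set (Set Y)} (h𝒲 : IsCov 𝒲)
    (hfB : ∀ f' : C(X, Y), Close 𝒲 f f' → ApproxOn D f' B) : ApproxOn D f (A ∪ B) := by
  intro 𝒰 h𝒰
  have := h.isANR.1
  obtain ⟨𝒰', h𝒰', htr⟩ := h𝒰.exists_half
  obtain ⟨g₁, hfg₁, hg₁⟩ := hfA _ (h𝒰'.inter h𝒲)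
  obtain ⟨𝒪, h𝒪, hopen⟩ := h.exists_cov_of_mem (h.of_isClosed hX hA) hg₁
  obtain ⟨g₂, hg₁₂, hg₂⟩ := hfB g₁ hfg₁.inter.2 _ (h𝒰'.inter h𝒪)
  exact ⟨g₂, htr hfg₁.inter.1 hg₁₂.inter.1, h.restrict_union hX hA hB
    (hopen _ (hg₁₂.inter.2.comp Subtype.val)) hg₂⟩

/-- If a closed set `A` factors through a space `P` all maps of which can be approximated, then all
maps can be approximated on `A`. -/
theorem approxOn_of_factor (hX : TopCat.of X ∈ T) {A : Set X} (hA : IsClosed A)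
    (hP : TopCat.of P ∈ T) (φ : C(A, P)) {f : C(X, Y)} (ψ : C(P, Y)) (hψ : Approx D ψ)
    (hφ : ∀ a, ψ (φ a) = f a) : ApproxOn D f A := by
  refine h.approxOn_of_restrict hX hA fun 𝒰 h𝒰 => ?_
  obtain ⟨g, hg, hψg⟩ := hψ 𝒰 h𝒰
  refine ⟨g.comp φ, h.comp_mem (h.of_isClosed hX hA) hP φ hg, fun a => ?_⟩
  obtain ⟨U, hU, h1, h2⟩ := hψg (φ a)
  exact ⟨U, hU, by simpa [hφ] using h1, h2⟩

/-! ### From small maps to all maps -/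

/-- The property of an open set `G ⊆ Y` that every map `f` can be approximated on each closed set
`A` with `closure (f '' A) ⊆ G` is inherited by the union of two such sets. -/
theorem approxOn_union_target (hX : TopCat.of X ∈ T) {G₁ G₂ : Set Y} (hG₁ : IsOpen G₁)
    (hG₂ : IsOpen G₂)
    (h₁ : ∀ (A : Set X) (f : C(X, Y)), IsClosed A → closure (f '' A) ⊆ G₁ → ApproxOn D f A)
    (h₂ : ∀ (A : Set X) (f : C(X, Y)), IsClosed A → closure (f '' A) ⊆ G₂ → ApproxOn D f A)
    (A : Set X) (f : C(X, Y)) (hA : IsClosed A) (hf : closure (f '' A) ⊆ G₁ ∪ G₂) :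
    ApproxOn D f A := by
  have := h.isANR.1
  let := TopologicalSpace.metrizableSpaceMetric Y
  obtain ⟨O₁, hO₁, hF₁, hOG₁⟩ := normal_exists_closure_subset (s := closure (f '' A) \ G₂)
    (isClosed_closure.sdiff hG₂) hG₁ fun y hy => (hf hy.1).resolve_right hy.2
  have hF₂ : closure (f '' A) \ O₁ ⊆ G₂ := fun y hy => by
    by_contra hy'
    exact hy.2 (hF₁ ⟨hy.1, hy'⟩)
  obtain ⟨O₂, hO₂, hFO₂, hOG₂⟩ := normal_exists_closure_subset (isClosed_closure.sdiff hO₁) hG₂ hF₂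
  have hA₁ : IsClosed (A ∩ f ⁻¹' closure O₁) := hA.inter (isClosed_closure.preimage f.continuous)
  have hA₂ : IsClosed (A ∩ f ⁻¹' (closure (f '' A) \ O₁)) :=
    hA.inter ((isClosed_closure.sdiff hO₁).preimage f.continuous)
  have hAA : A = A ∩ f ⁻¹' closure O₁ ∪ A ∩ f ⁻¹' (closure (f '' A) \ O₁) := by
    ext x
    by_cases hx : f x ∈ O₁
    · simp [hx, subset_closure hx]
    · simp only [mem_union, mem_inter_iff, mem_preimage, mem_sdiff, hx, not_false_eq_true, and_true]
      exact ⟨fun hxA => Or.inr ⟨hxA, subset_closure (mem_image_of_mem f hxA)⟩, fun h => h.elim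
        And.left And.left⟩
  rw [hAA]
  refine h.approxOn_union hX hA₁ hA₂ (h₁ _ f hA₁ ?_)
    (isCov_pair (isClosed_closure.sdiff hO₁) hO₂ hFO₂) fun f' hff' => h₂ _ f' hA₂ ?_
  · refine Subset.trans (closure_minimal ?_ isClosed_closure) hOG₁
    rintro _ ⟨x, hx, rfl⟩
    exact hx.2
  · refine Subset.trans (closure_mono ?_) hOG₂
    rintro _ ⟨x, hx, rfl⟩
    exact hff'.mem_of_mem hx.2

/-- The property of `approxOn_union_target` is inherited by disjoint unions of open sets. The
approximations over the members of the union are glued by the axiom on discrete families; keeping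
the images inside of an open set `O` whose closure lies in the union makes them discrete. -/
theorem approxOn_iUnion_target (hX : TopCat.of X ∈ T) {ι : Type u} {G : ι → Set Y}
    (hG : ∀ t, IsOpen (G t)) (hdisj : ∀ s t y, y ∈ G s → y ∈ G t → s = t)
    (hGA : ∀ t (A : Set X) (f : C(X, Y)), IsClosed A → closure (f '' A) ⊆ G t → ApproxOn D f A)
    (A : Set X) (f : C(X, Y)) (hA : IsClosed A) (hf : closure (f '' A) ⊆ ⋃ t, G t) :
    ApproxOn D f A := by
  intro 𝒰 h𝒰
  have := h.isANR.1
  have hnX := h.normalSpace hX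
  let := TopologicalSpace.metrizableSpaceMetric Y
  obtain ⟨𝒱, h𝒱, hext⟩ := h.isANR.exists_extension h𝒰
  set F := closure (f '' A) with hF
  have hFc : IsClosed F := isClosed_closure
  have hAF : ∀ x ∈ A, f x ∈ F := fun x hx => subset_closure (mem_image_of_mem f hx)
  obtain ⟨O, hO, hFO, hOG⟩ := normal_exists_closure_subset hFc (isOpen_iUnion hG) hf
  let 𝒢 : Set (Set Y) := insert Fᶜ (range fun t => O ∩ G t)
  have h𝒢 : IsCov 𝒢 := by
    refine isCov_of_forall_mem ?_ fun y => ?_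
    · rintro _ (rfl | ⟨t, rfl⟩)
      exacts [hFc.isOpen_compl, hO.inter (hG t)]
    · by_cases hy : y ∈ F
      · obtain ⟨t, ht⟩ := mem_iUnion.1 (hf hy)
        exact ⟨O ∩ G t, Or.inr ⟨t, rfl⟩, hFO hy, ht⟩
      · exact ⟨Fᶜ, Or.inl rfl, hy⟩
  have hFt : ∀ t, IsClosed (F ∩ ⋂ s ∈ {s | s ≠ t}, (G s)ᶜ) := fun t =>
    hFc.inter (isClosed_biInter fun s _ => (hG s).isClosed_compl)
  have hFt' : ∀ t, F ∩ ⋂ s ∈ {s | s ≠ t}, (G s)ᶜ = F ∩ G t := by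
    intro t
    ext y
    simp only [mem_inter_iff, mem_iInter, mem_ofPred_eq, mem_compl_iff, and_congr_right_iff]
    intro hy
    obtain ⟨s, hs⟩ := mem_iUnion.1 (hf hy)
    constructor
    · intro hy'
      by_cases hst : s = t
      exacts [hst ▸ hs, absurd hs (hy' s hst)]
    · exact fun ht s' hs' hy' => hs' (hdisj _ _ _ hy' ht)
  have hFt : ∀ t, IsClosed (F ∩ G t) := fun t => hFt' t ▸ hFt t
  have hAt : ∀ t, IsClosed (A ∩ f ⁻¹' (F ∩ G t)) := fun t =>
    hA.inter ((hFt t).preimage f.continuous)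
  have hex : ∀ t, ∃ g : C(X, Y), Close (image2 (· ∩ ·) 𝒱 𝒢) f g ∧
      g.restrict (A ∩ f ⁻¹' (F ∩ G t)) ∈ D (TopCat.of (A ∩ f ⁻¹' (F ∩ G t) : Set X)) := by
    intro t
    refine hGA t _ f (hAt t) ?_ _ (h𝒱.inter h𝒢)
    refine Subset.trans (closure_minimal ?_ (hFt t)) inter_subset_right
    rintro _ ⟨x, hx, rfl⟩
    exact hx.2
  choose g hfg hg using hex
  have hτ : ∀ a : A, ∃ t, f a ∈ G t := fun a => mem_iUnion.1 (hf (hAF a a.2))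
  choose τ hτ using hτ
  have hτu : ∀ (a : A) t, f a ∈ G t → τ a = t := fun a t ht => hdisj _ _ _ (hτ a) ht
  have hnear : ∀ (a : A) t, f a ∈ G t → ∀ᶠ b : A in 𝓝 a, τ b = t := by
    intro a t ht
    have : ∀ᶠ b : A in 𝓝 a, f b ∈ G t :=
      (f.continuous.comp continuous_subtype_val).continuousAt.eventually ((hG t).mem_nhds ht)
    filter_upwards [this] with b hb using hτu b t hb
  let g₀ : C(A, Y) := ⟨fun a => g (τ a) a, continuous_iff_continuousAt.2 fun a =>
    ((g (τ a)).continuous.comp continuous_subtype_val).continuousAt.congr <| by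
      filter_upwards [hnear a _ (hτ a)] with b hb
      simp [hb]⟩
  have hg₀ : ∀ a, g₀ a = g (τ a) a := fun a => rfl
  have hOt : ∀ (a : A), g₀ a ∈ O ∩ G (τ a) := by
    intro a
    obtain ⟨U, hU, h1, h2⟩ := (hfg (τ a)).inter.2 a
    rcases hU with rfl | ⟨t, rfl⟩
    · exact absurd (hAF a a.2) h1
    · rw [hτu a t h1.2]
      rw [hτu a t h1.2] at h2
      rw [hg₀, hτu a t h1.2]
      exact h2
  have hAT := h.of_isClosed hX hA
  have hg₀D : g₀ ∈ D (TopCat.of A) := by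
    refine h.isNormalSystem.discrete_mem (TopCat.of A) hAT ι
      (fun t => (↑) ⁻¹' (A ∩ f ⁻¹' (F ∩ G t))) (fun t => (hAt t).preimage continuous_subtype_val)
      ?_ ?_ g₀ ?_ ?_
    · intro a
      refine ⟨{b | τ b = τ a}, hnear a _ (hτ a), fun s t => ?_⟩
      rintro ⟨b, hb, -, -, hbs⟩ ⟨c, hc, -, -, hct⟩
      exact ((hτu b s hbs).symm.trans hb).trans ((hτu c t hct).symm.trans hc).symm
    · exact eq_univ_of_forall fun a => mem_iUnion.2 ⟨τ a, a.2, hAF a a.2, hτ a⟩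
    · intro t
      have := h.comp_mem (h.of_isClosed hAT ((hAt t).preimage continuous_subtype_val))
        (h.of_isClosed hX (hAt t)) ⟨fun x => ⟨x.1.1, x.2⟩, by fun_prop⟩ (hg t)
      convert this using 1
      ext a
      have : τ a.1 = t := hτu a.1 t a.2.2.2
      change g₀ a.1 = g t a.1
      rw [hg₀, this]
    · intro y
      have himg : ∀ t, g₀ '' ((↑) ⁻¹' (A ∩ f ⁻¹' (F ∩ G t))) ⊆ O ∩ G t := by
        rintro t _ ⟨a, ha, rfl⟩
        have := hOt a
        rwa [hτu a t ha.2.2] at this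
      by_cases hy : y ∈ ⋃ t, G t
      · obtain ⟨r, hr⟩ := mem_iUnion.1 hy
        refine ⟨G r, (hG r).mem_nhds hr, fun s t => ?_⟩
        rintro ⟨b, hb, hbs⟩ ⟨c, hc, hct⟩
        exact (hdisj s r b (himg s hbs).2 hb).trans (hdisj t r c (himg t hct).2 hc).symm
      · refine ⟨(closure O)ᶜ, isClosed_closure.isOpen_compl.mem_nhds fun h' => hy (hOG h'),
          fun s t => ?_⟩
        rintro ⟨b, hb, hbs⟩ -
        exact absurd (subset_closure (himg s hbs).1) hb
  obtain ⟨g', hg', hfg'⟩ := hext (h.nbhdExtensor hX) hA f g₀ fun a => (hfg (τ a)).inter.1 a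
  exact ⟨g', hfg', hg' ▸ hg₀D⟩

/-- The property of `approxOn_union_target` is inherited by increasing unions of open sets exhausting
the space, which is the union of two disjoint unions of shells. -/
theorem approxOn_of_exhaustion (hX : TopCat.of X ∈ T) {G : ℕ → Set Y} (hG : ∀ n, IsOpen (G n))
    (hmono : Monotone G) (hcov : ∀ y, ∃ n, y ∈ G n)
    (hGA : ∀ n (A : Set X) (f : C(X, Y)), IsClosed A → closure (f '' A) ⊆ G n → ApproxOn D f A)
    (A : Set X) (f : C(X, Y)) (hA : IsClosed A) : ApproxOn D f A := by
  have := h.isANR.1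
  let := TopologicalSpace.metrizableSpaceMetric Y
  obtain ⟨s, hs⟩ : ∃ s : C(Y, ℝ), ∀ y, s y ∈ {c : ℝ | ∀ n : ℕ, c ≤ n → y ∈ G n} := by
    refine exists_continuous_forall_mem_convex_of_local_const (fun y => ?_) fun y => ?_
    · refine OrdConnected.convex (IsUpperSet.ordConnected fun a b hab ha n hn => ?_)
      exact ha n (hab.trans hn)
    · obtain ⟨n, hn⟩ := hcov y
      refine ⟨n, ?_⟩
      filter_upwards [(hG n).mem_nhds hn] with z hz m hm
      exact hmono (by exact_mod_cast hm) hz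
  -- the even and the odd shells
  have hshell : ∀ e : ℤ, ∀ (A : Set X) (f : C(X, Y)), IsClosed A →
      closure (f '' A) ⊆ ⋃ j : ULift.{u} ℤ, {y | (2 * j.down + e - 1 : ℝ) < s y ∧
        s y < 2 * j.down + e + 1} → ApproxOn D f A := by
    intro e
    refine h.approxOn_iUnion_target hX (fun j => ?_) ?_ fun j A f hA hf => ?_
    · exact (isOpen_lt continuous_const s.continuous).inter (isOpen_lt s.continuous continuous_const)
    · rintro ⟨i⟩ ⟨j⟩ y ⟨h1, h2⟩ ⟨h3, h4⟩
      simp only at h1 h2 h3 h4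
      have h5 : ((2 * i + e - 1 : ℤ) : ℝ) < (2 * j + e + 1 : ℤ) := by push_cast; linarith
      have h6 : ((2 * j + e - 1 : ℤ) : ℝ) < (2 * i + e + 1 : ℤ) := by push_cast; linarith
      have h7 := Int.cast_lt.1 h5
      have h8 := Int.cast_lt.1 h6
      congr 1
      omega
    · refine hGA (2 * j.down + e + 1).toNat A f hA fun y hy => hs y _ ?_
      have h1 : ((2 * j.down + e + 1 : ℤ) : ℝ) ≤ ((2 * j.down + e + 1).toNat : ℕ) := by
        rw [← Int.cast_natCast]
        exact Int.cast_le.2 (Int.self_le_toNat _)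
      refine (hf hy).2.le.trans (le_trans (le_of_eq ?_) h1)
      push_cast
      ring
  have hopen : ∀ e : ℤ, IsOpen (⋃ j : ULift.{u} ℤ, {y | (2 * j.down + e - 1 : ℝ) < s y ∧
        s y < 2 * j.down + e + 1}) := fun e => isOpen_iUnion fun j =>
    (isOpen_lt continuous_const s.continuous).inter (isOpen_lt s.continuous continuous_const)
  refine h.approxOn_union_target hX (hopen 0) (hopen 1) (hshell 0) (hshell 1) A f hA fun y _ => ?_
  have hfl := Int.floor_le (s y)
  have hfl' := Int.lt_floor_add_one (s y)
  rcases Int.even_or_odd' ⌊s y⌋ with ⟨j, hj | hj⟩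
  · rw [hj] at hfl hfl'
    push_cast at hfl hfl'
    exact Or.inl (mem_iUnion.2 ⟨⟨j⟩, by
      simp only [mem_ofPred_eq]
      constructor <;> push_cast <;> linarith⟩)
  · rw [hj] at hfl hfl'
    push_cast at hfl hfl'
    exact Or.inr (mem_iUnion.2 ⟨⟨j⟩, by
      simp only [mem_ofPred_eq]
      constructor <;> push_cast <;> linarith⟩)

/-- If all maps into members of an open cover can be approximated, then so can be all maps. The
proof follows Stone's theorem: a well-ordering of the cover gives a sequence of disjoint
families of open sets, subordinate to the cover, whose union covers `Y`. -/
theorem approxOn_of_local (hX : TopCat.of X ∈ T) {𝒱 : Set (Set Y)} (h𝒱 : IsCov 𝒱)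
    (hloc : ∀ V ∈ 𝒱, ∀ (A : Set X) (f : C(X, Y)), IsClosed A → closure (f '' A) ⊆ V →
      ApproxOn D f A) (A : Set X) (f : C(X, Y)) (hA : IsClosed A) : ApproxOn D f A := by
  have := h.isANR.1
  let := TopologicalSpace.metrizableSpaceMetric Y
  let ρ : ℕ → ℝ := fun n => 1 / ((n : ℝ) + 1)
  have hρ : ∀ n, 0 < ρ n := fun n => by positivity
  let H : ℕ → 𝒱 → Set Y := fun n V =>
    {y | Metric.ball y (ρ n) ⊆ V ∧ ∀ W : 𝒱, WellOrderingRel W V → y ∉ (W : Set Y)}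
  let O : ℕ → 𝒱 → Set Y := fun n V => Metric.thickening (ρ n / 2) (H n V)
  have hOV : ∀ n V, O n V ⊆ V := by
    intro n V y hy
    obtain ⟨z, hz, hyz⟩ := Metric.mem_thickening_iff.1 hy
    exact hz.1 (Metric.mem_ball.2 (hyz.trans (half_lt_self (hρ n))))
  have hdisj : ∀ n V W y, y ∈ O n V → y ∈ O n W → V = W := by
    intro n V W y hV hW
    obtain ⟨z, hz, hyz⟩ := Metric.mem_thickening_iff.1 hV
    obtain ⟨w, hw, hyw⟩ := Metric.mem_thickening_iff.1 hW
    have hzw : dist z w < ρ n := by linarith [dist_triangle_left z w y]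
    rcases trichotomous_of WellOrderingRel V W with hVW | hVW | hVW
    · exact absurd (hz.1 (by rwa [Metric.mem_ball, dist_comm])) (hw.2 V hVW)
    · exact hVW
    · exact absurd (hw.1 (Metric.mem_ball.2 hzw)) (hz.2 W hVW)
  have hO : ∀ n, IsOpen (⋃ V, O n V) := fun n => isOpen_iUnion fun V => Metric.isOpen_thickening
  have hP : ∀ n (A : Set X) (f : C(X, Y)), IsClosed A → closure (f '' A) ⊆ ⋃ V, O n V →
      ApproxOn D f A := fun n =>
    h.approxOn_iUnion_target hX (fun V => Metric.isOpen_thickening) (hdisj n)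
      fun V A f hA hf => hloc V V.2 A f hA (hf.trans (hOV n V))
  have hacc : ∀ n, IsOpen (Set.accumulate (fun n => ⋃ V, O n V) n) := fun n =>
    isOpen_biUnion fun m _ => hO m
  refine h.approxOn_of_exhaustion hX hacc monotone_accumulate (fun y => ?_) (fun n => ?_) A f hA
  · have hne : {V : 𝒱 | y ∈ (V : Set Y)}.Nonempty :=
      let ⟨V, hV, hy⟩ := h𝒱.exists_mem y
      ⟨⟨V, hV⟩, hy⟩
    have hwf : WellFounded (WellOrderingRel (α := 𝒱)) := IsWellFounded.wf
    set V := hwf.min _ hne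
    have hV : y ∈ (V : Set Y) := hwf.min_mem _ hne
    obtain ⟨ε, hε, hb⟩ := Metric.isOpen_iff.1 (h𝒱.1 V V.2) y hV
    obtain ⟨n, hn⟩ := exists_nat_one_div_lt hε
    refine ⟨n, mem_biUnion (le_refl n) (mem_iUnion.2 ⟨V, ?_⟩)⟩
    refine Metric.self_subset_thickening (by linarith [hρ n]) _ ⟨?_, fun W hW hy => ?_⟩
    · exact (Metric.ball_subset_ball hn.le).trans hb
    · exact hwf.not_lt_min _ hy hW
  · induction n with
    | zero => simpa [Set.accumulate] using hP 0
    | succ n ih =>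
      rw [accumulate_succ]
      exact h.approxOn_union_target hX (hacc n) (hO (n + 1)) ih (hP (n + 1))

/-- If all small maps on `P` can be approximated, then so can be all maps on closed subspaces `A` of
`P`. Indeed, small maps on closed subsets of `A` extend to small maps on `P`. -/
theorem approx_of_small {A : Type u} [TopologicalSpace A] (hA : TopCat.of A ∈ T)
    (hP : TopCat.of P ∈ T) {i : A → P} (hi : IsClosedEmbedding i) {𝒰₀ : Set (Set Y)}
    (h𝒰₀ : IsCov 𝒰₀)
    (hsmall : ∀ f : C(P, Y), (∃ U ∈ 𝒰₀, closure (range f) ⊆ U) → Approx D f) (f : C(A, Y)) :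
    Approx D f := by
  have := h.isANR.1
  let := TopologicalSpace.metrizableSpaceMetric Y
  have hnP := h.normalSpace hP
  have h𝒩 : IsCov {N : Set Y | IsOpen N ∧ ∃ U ∈ 𝒰₀, closure N ⊆ U} := by
    refine isCov_of_forall_mem (fun N hN => hN.1) fun y => ?_
    obtain ⟨U, hU, hy⟩ := h𝒰₀.exists_mem y
    obtain ⟨N, hN, hyN, hNU⟩ := normal_exists_closure_subset isClosed_singleton (h𝒰₀.1 U hU)
      (singleton_subset_iff.2 hy)
    exact ⟨N, ⟨hN, U, hU, hNU⟩, hyN rfl⟩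
  obtain ⟨𝒲, h𝒲, hbar⟩ := h𝒩.exists_barycentric
  obtain ⟨𝒱, h𝒱, hext⟩ := h.isANR.exists_extension h𝒲
  refine h.approx_of_approxOn_univ hA (h.approxOn_of_local hA h𝒱 (fun V hV B f hB hfV => ?_) _ f
    isClosed_univ)
  refine h.approxOn_of_restrict hA hB ?_
  have hBT := h.of_isClosed hA hB
  rcases B.eq_empty_or_nonempty with hE | ⟨b₀, hb₀⟩
  · have : IsEmpty B := isEmpty_coe_sort.2 hE
    exact fun 𝒰 h𝒰 => ⟨_, h.mem_of_isEmpty hBT _, h𝒰.close_refl _⟩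
  have hfB : ∀ b : B, f b ∈ V := fun b => hfV (subset_closure (mem_image_of_mem f b.2))
  have hj : IsClosedEmbedding fun b : B => i b := hi.comp hB.isClosedEmbedding_subtypeVal
  let e := hj.isEmbedding.toHomeomorph
  obtain ⟨f', hf', hcl⟩ := hext (h.nbhdExtensor hP) hj.isClosed_range (ContinuousMap.const P (f b₀))
    ((f.restrict B).comp (e.symm : C(range fun b : B => i b, B)))
    fun p => ⟨V, hV, hfB ⟨b₀, hb₀⟩, hfB (e.symm p)⟩
  have hf'i : ∀ b : B, f' (i b) = f b := fun b => by
    have : f' (e b) = f b := by simpa using DFunLike.congr_fun hf' (e b)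
    exact this
  have hf's : Approx D f' := by
    obtain ⟨N, ⟨-, U, hU, hNU⟩, hst⟩ := hbar (f b₀)
    refine hsmall f' ⟨U, hU, Subset.trans (closure_mono ?_) hNU⟩
    rintro _ ⟨p, rfl⟩
    obtain ⟨W, hW, h1, h2⟩ := hcl p
    exact hst W hW h1 h2
  intro 𝒰 h𝒰
  obtain ⟨g, hg, hfg⟩ := hf's 𝒰 h𝒰
  refine ⟨g.comp ⟨fun b : B => i b, hj.continuous⟩, h.comp_mem hBT hP _ hg, fun b => ?_⟩
  have := hfg (i b)
  rwa [hf'i] at this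

/-- A space with SMAP: all maps on its closed subspaces can be approximated. -/
theorem approx_of_smap {A : Type u} [TopologicalSpace A] (hA : TopCat.of A ∈ T)
    (hP : TopCat.of P ∈ T) {i : A → P} (hi : IsClosedEmbedding i) (hs : SMAP (D (TopCat.of P)))
    (f : C(A, Y)) : Approx D f := by
  obtain ⟨𝒰₀, h𝒰₀, hsub⟩ := hs
  have := h.isANR.1
  exact h.approx_of_small hA hP hi h𝒰₀
    (fun f hf 𝒰 h𝒰 => exists_close_of_mem_closure (hsub hf) h𝒰) f

/-! ### Unions of two spaces outside of the class -/

omit h in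
/-- Controlled extension over the union of two closed subspaces, one of which belongs to the
class. -/
theorem exists_extension_of_isClosedEmbedding (h : IsSetting T D) {𝒰 : Set (Set Y)}
    (h𝒰 : IsCov 𝒰) : ∃ 𝒱 : Set (Set Y), IsCov 𝒱 ∧ ∀ {N : Type w} {P Q : Type u} [TopologicalSpace N]
      [TopologicalSpace P] [TopologicalSpace Q] {e : P → N} {o : Q → N}, IsClosedEmbedding e →
      IsClosedEmbedding o → range e ∪ range o = univ → TopCat.of Q ∈ T → ∀ (ψ : C(N, Y))
      (g : C(P, Y)), Close 𝒱 (fun p => ψ (e p)) g →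
        ∃ ψ' : C(N, Y), (∀ p, ψ' (e p) = g p) ∧ Close 𝒰 ψ ψ' := by
  obtain ⟨𝒱, h𝒱, hext⟩ := h.isANR.exists_extension h𝒰
  have hmono := h𝒱.inter h𝒰
  refine ⟨_, hmono, fun {N P Q} _ _ _ e o he ho hcov hQ ψ g hψg => ?_⟩
  have := h.normalSpace hQ
  let E := he.isEmbedding.toHomeomorph
  have hB : IsClosed (o ⁻¹' range e) := he.isClosed_range.preimage ho.continuous
  let β : C(o ⁻¹' range e, P) := ⟨fun q => E.symm ⟨o q, q.2⟩,
    E.symm.continuous.comp ((ho.continuous.comp continuous_subtype_val).subtype_mk _)⟩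
  have hβ : ∀ q, e (β q) = o q := fun q => congrArg Subtype.val (E.apply_symm_apply ⟨o q, q.2⟩)
  obtain ⟨g', hg', hcl⟩ := hext (h.nbhdExtensor hQ) hB (ψ.comp ⟨o, ho.continuous⟩) (g.comp β)
    fun q => by
      have : ∃ U ∈ 𝒱, ψ (e (β q)) ∈ U ∧ g (β q) ∈ U := hψg.inter.1 (β q)
      rw [hβ] at this
      exact this
  let π : C(P ⊕ Q, N) := ⟨Sum.elim e o, he.continuous.sumElim ho.continuous⟩
  have hquot : IsQuotientMap π := by
    refine ((he.isClosedMap.sumElim ho.isClosedMap).isQuotientMap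
      (he.continuous.sumElim ho.continuous) fun n => ?_)
    have : n ∈ range e ∪ range o := hcov ▸ mem_univ n
    simpa using this
  have hfib : ∀ p q, e p = o q → g p = g' q := by
    intro p q hpq
    have h1 : β ⟨q, p, hpq⟩ = p := he.injective ((hβ ⟨q, p, hpq⟩).trans hpq.symm)
    have h2 := DFunLike.congr_fun hg' ⟨q, p, hpq⟩
    have h3 : g' q = g (β ⟨q, p, hpq⟩) := h2
    rw [h3, h1]
  let s : C(P ⊕ Q, Y) := ⟨Sum.elim g g', g.continuous.sumElim g'.continuous⟩
  have hs : Function.FactorsThrough s π := by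
    rintro (p | q) (p' | q') hab
    · exact congrArg g (he.injective hab)
    · exact hfib p q' hab
    · exact (hfib p' q hab.symm).symm
    · exact congrArg g' (ho.injective hab)
  have hlift : ∀ a, hquot.lift s hs (π a) = s a := fun a =>
    DFunLike.congr_fun (hquot.lift_comp s hs) a
  refine ⟨hquot.lift s hs, fun p => hlift (Sum.inl p), fun n => ?_⟩
  obtain ⟨a, rfl⟩ := hquot.surjective n
  rw [hlift]
  rcases a with p | q
  · exact hψg.inter.2 p
  · exact hcl q

/-- If a space `N`, not necessarily in the class, is the union of two closed subspaces which belong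
to the class and all maps of which can be approximated, then every map on `N` is a limit of maps
whose restrictions to both subspaces belong to the system. -/
theorem exists_close_of_union {N : Type w} [TopologicalSpace N] {e : P → N} {o : Q → N}
    (he : IsClosedEmbedding e) (ho : IsClosedEmbedding o) (hcov : range e ∪ range o = univ)
    (hP : TopCat.of P ∈ T) (hQ : TopCat.of Q ∈ T) (hPa : ∀ f : C(P, Y), Approx D f)
    (hQa : ∀ f : C(Q, Y), Approx D f) (ψ : C(N, Y)) {𝒰 : Set (Set Y)} (h𝒰 : IsCov 𝒰) :
    ∃ ψ' : C(N, Y), Close 𝒰 ψ ψ' ∧ ψ'.comp ⟨e, he.continuous⟩ ∈ D (TopCat.of P) ∧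
      ψ'.comp ⟨o, ho.continuous⟩ ∈ D (TopCat.of Q) := by
  have := h.isANR.1
  obtain ⟨𝒰', h𝒰', htr⟩ := h𝒰.exists_half
  obtain ⟨𝒱, h𝒱, hext⟩ := h.exists_extension_of_isClosedEmbedding h𝒰'
  obtain ⟨g, hg, hψg⟩ := hPa (ψ.comp ⟨e, he.continuous⟩) 𝒱 h𝒱
  obtain ⟨ψ₁, hψ₁, hcl₁⟩ := hext he ho hcov hQ ψ g hψg
  have hψ₁' : ψ₁.comp ⟨e, he.continuous⟩ = g := ContinuousMap.ext hψ₁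
  obtain ⟨𝒪, h𝒪, hopen⟩ := h.exists_cov_of_mem hP hg
  obtain ⟨𝒱₂, h𝒱₂, hext₂⟩ := h.exists_extension_of_isClosedEmbedding (h𝒰'.inter h𝒪)
  obtain ⟨g₂, hg₂, hψg₂⟩ := hQa (ψ₁.comp ⟨o, ho.continuous⟩) 𝒱₂ h𝒱₂
  obtain ⟨ψ₂, hψ₂, hcl₂⟩ := hext₂ ho he (by rw [union_comm, hcov]) hP ψ₁ g₂ hψg₂
  have hψ₂' : ψ₂.comp ⟨o, ho.continuous⟩ = g₂ := ContinuousMap.ext hψ₂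
  refine ⟨ψ₂, htr hcl₁ hcl₂.inter.1, hopen _ ?_, hψ₂' ▸ hg₂⟩
  rw [← hψ₁']
  exact hcl₂.inter.2.comp e

end IsSetting

end Systems

/-! ### Geometric realizations -/

section Realizations

variable {ι : Type u} {K L : AbstractSimplicialComplex ι} {τ : ComplexTopology}

/-- The point of the Hilbert space underlying a point of a geometric realization. -/
def Realization.point (x : Realization K τ) : lp (fun _ : ι => ℝ) 2 := (x : carrier K).1

/-- The barycentric coordinates of a point of a geometric realization. -/
def Realization.coord (x : Realization K τ) (v : ι) : ℝ := x.point v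

theorem Realization.ext {x y : Realization K τ} (hxy : ∀ v, x.coord v = y.coord v) : x = y := by
  have : x.point = y.point := lp.ext (funext hxy)
  exact Subtype.ext (a1 := (x : carrier K)) (a2 := (y : carrier K)) this

/-- The point of the realization with a given position in a simplex of the complex. -/
def ofSimplex (K : AbstractSimplicialComplex ι) (τ : ComplexTopology) {σ : Finset ι}
    (hσ : σ ∈ K.faces) (x : simplex σ) : Realization K τ :=
  (⟨x.1, mem_biUnion hσ x.2⟩ : carrier K)

theorem continuous_point_metric : Continuous (Realization.point : Realization K .metric → _) :=
  continuous_subtype_val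

theorem isEmbedding_point_metric : IsEmbedding (Realization.point : Realization K .metric → _) :=
  IsEmbedding.subtypeVal

theorem continuous_weak_iff {W : Type*} [TopologicalSpace W] {f : Realization K .weak → W} :
    Continuous f ↔ ∀ (σ : Finset ι) (hσ : σ ∈ K.faces),
      Continuous fun x : simplex σ => f (ofSimplex K .weak hσ x) := by
  refine continuous_iSup_dom.trans ⟨fun h σ hσ => ?_, fun h σ => ?_⟩
  · exact continuous_coinduced_dom.1 (h ⟨σ, hσ⟩)
  · exact continuous_coinduced_dom.2 (h σ.1 σ.2)

theorem isClosed_weak_iff {C : Set (Realization K .weak)} :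
    IsClosed C ↔ ∀ (σ : Finset ι) (hσ : σ ∈ K.faces), IsClosed (ofSimplex K .weak hσ ⁻¹' C) := by
  refine isClosed_iSup_iff.trans ⟨fun h σ hσ => ?_, fun h σ => ?_⟩
  · exact isClosed_coinduced.1 (h ⟨σ, hσ⟩)
  · exact isClosed_coinduced.2 (h σ.1 σ.2)

theorem continuous_ofSimplex {σ : Finset ι} (hσ : σ ∈ K.faces) :
    Continuous (ofSimplex K τ hσ) := by
  cases τ
  · exact continuous_weak_iff.1 continuous_id σ hσ
  · exact isEmbedding_point_metric.continuous_iff.2 continuous_subtype_val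

theorem continuous_point : Continuous (Realization.point : Realization K τ → _) := by
  cases τ
  · exact continuous_weak_iff.2 fun σ hσ => continuous_subtype_val
  · exact continuous_point_metric

theorem continuous_coord (v : ι) : Continuous fun x : Realization K τ => x.coord v :=
  (lp.evalCLM ℝ (fun _ : ι => ℝ) 2 v).continuous.comp continuous_point

/-- The identity `|K|_τ → |K|_m`. -/
def idToMetric (K : AbstractSimplicialComplex ι) (τ : ComplexTopology) :
    C(Realization K τ, Realization K .metric) :=
  ⟨fun x => x, isEmbedding_point_metric.continuous_iff.2 continuous_point⟩

/-- The identity `|K|_w → |K|_τ`. -/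
def idOfWeak (K : AbstractSimplicialComplex ι) (τ : ComplexTopology) :
    C(Realization K .weak, Realization K τ) :=
  ⟨fun x => x, continuous_weak_iff.2 fun _ hσ => continuous_ofSimplex (τ := τ) hσ⟩

theorem Realization.exists_mem_simplex (x : Realization K τ) :
    ∃ σ ∈ K.faces, x.point ∈ simplex σ := by
  obtain ⟨σ, hσ, hx⟩ := mem_iUnion₂.1 (show carrier K from x).2
  exact ⟨σ, hσ, hx⟩

theorem Realization.coord_nonneg (x : Realization K τ) (v : ι) : 0 ≤ x.coord v :=
  let ⟨_, _, h⟩ := x.exists_mem_simplex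
  h.1 v

theorem Realization.finite_support (x : Realization K τ) : {v | x.coord v ≠ 0}.Finite := by
  obtain ⟨σ, -, h⟩ := x.exists_mem_simplex
  refine σ.finite_toSet.subset fun v hv => ?_
  by_contra hvσ
  exact hv (h.2.1 v hvσ)

/-- The vertices of the smallest simplex containing a given point. -/
noncomputable def Realization.supp (x : Realization K τ) : Finset ι := x.finite_support.toFinset

theorem Realization.mem_supp {x : Realization K τ} {v : ι} : v ∈ x.supp ↔ x.coord v ≠ 0 := by
  simp [Realization.supp]

theorem Realization.mem_supp_iff_pos {x : Realization K τ} {v : ι} :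
    v ∈ x.supp ↔ 0 < x.coord v :=
  mem_supp.trans (x.coord_nonneg v).lt_iff_ne'.symm

theorem Realization.sum_coord {x : Realization K τ} {σ : Finset ι} (hσ : x.supp ⊆ σ) :
    ∑ v ∈ σ, x.coord v = 1 := by
  obtain ⟨ρ, -, h⟩ := x.exists_mem_simplex
  have h1 : x.supp ⊆ ρ := fun v hv => by
    by_contra hvρ
    exact mem_supp.1 hv (h.2.1 v hvρ)
  have h2 : ∀ {σ}, x.supp ⊆ σ → ∑ v ∈ σ, x.coord v = ∑ v ∈ x.supp, x.coord v := fun hs =>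
    (Finset.sum_subset hs fun v _ hv => by simpa [mem_supp] using hv).symm
  rw [h2 hσ, ← h2 h1]
  exact h.2.2

theorem Realization.coord_le_one (x : Realization K τ) (v : ι) : x.coord v ≤ 1 := by
  by_cases hv : v ∈ x.supp
  · rw [← x.sum_coord Subset.rfl]
    exact Finset.single_le_sum (fun w _ => x.coord_nonneg w) hv
  · rw [show x.coord v = 0 by simpa [mem_supp] using hv]
    exact zero_le_one

theorem Realization.supp_nonempty (x : Realization K τ) : x.supp.Nonempty := by
  by_contra h
  have := x.sum_coord Subset.rfl
  rw [Finset.not_nonempty_iff_eq_empty.1 h] at this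
  simp at this

theorem Realization.supp_mem (x : Realization K τ) : x.supp ∈ K.faces := by
  obtain ⟨ρ, hρ, h⟩ := x.exists_mem_simplex
  refine (K.isRelLowerSet_faces hρ).2 (fun v hv => ?_) x.supp_nonempty
  by_contra hvρ
  exact mem_supp.1 hv (h.2.1 v hvρ)

theorem Realization.mem_simplex_iff {x : Realization K τ} {σ : Finset ι} :
    x.point ∈ simplex σ ↔ x.supp ⊆ σ := by
  refine ⟨fun h v hv => ?_, fun h => ⟨x.coord_nonneg, fun v hv => ?_, x.sum_coord h⟩⟩
  · by_contra hvρ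
    exact mem_supp.1 hv (h.2.1 v hvρ)
  · have := mt (@h v) hv
    simpa [mem_supp, Realization.coord] using this

theorem isClosed_supp_subset (σ : Finset ι) : IsClosed {x : Realization K τ | x.supp ⊆ σ} := by
  have : {x : Realization K τ | x.supp ⊆ σ} = ⋂ v ∈ {v | v ∉ σ}, {x | x.coord v = 0} := by
    ext x
    simp only [mem_ofPred_eq, mem_iInter]
    refine ⟨fun h v hv => ?_, fun h v hv => ?_⟩
    · by_contra h0
      exact hv (h (Realization.mem_supp.2 h0))
    · by_contra hvσ
      exact Realization.mem_supp.1 hv (h v hvσ)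
  rw [this]
  exact isClosed_biInter fun v _ => isClosed_eq (continuous_coord v) continuous_const

theorem eventually_supp_subset (x : Realization K τ) : ∀ᶠ y in 𝓝 x, x.supp ⊆ y.supp := by
  have : ∀ᶠ y in 𝓝 x, ∀ v ∈ x.supp, 0 < y.coord v := by
    rw [Finset.eventually_all]
    intro v hv
    exact (continuous_coord v).continuousAt.eventually
      (lt_mem_nhds (Realization.mem_supp_iff_pos.1 hv))
  filter_upwards [this] with y hy v hv using Realization.mem_supp_iff_pos.2 (hy v hv)

/-- The part of a realization consisting of the simplices of a subcomplex is closed. -/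
theorem isClosed_supp_mem (L : AbstractSimplicialComplex ι) :
    IsClosed {x : Realization K τ | x.supp ∈ L.faces} := by
  rw [← isOpen_compl_iff, isOpen_iff_mem_nhds]
  intro x hx
  filter_upwards [eventually_supp_subset x] with y hy hyL
  exact hx ((L.isRelLowerSet_faces hyL).2 hy x.supp_nonempty)

theorem isClosed_card_supp_le (n : ℕ) : IsClosed {x : Realization K τ | x.supp.card ≤ n} := by
  rw [← isOpen_compl_iff, isOpen_iff_mem_nhds]
  intro x hx
  filter_upwards [eventually_supp_subset x] with y hy hyL
  exact hx ((Finset.card_le_card hy).trans hyL)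

/-- A continuous family of points of a simplex, given by barycentric coordinates. -/
theorem exists_map_of_coord {W : Type*} [TopologicalSpace W] {σ : Finset ι} (hσ : σ ∈ K.faces)
    (c : W → ι → ℝ) (hc : ∀ v, Continuous fun w => c w v) (h0 : ∀ w v, 0 ≤ c w v)
    (hz : ∀ w, ∀ v ∉ σ, c w v = 0) (h1 : ∀ w, ∑ v ∈ σ, c w v = 1) :
    ∃ ψ : C(W, Realization K τ), ∀ w v, (ψ w).coord v = c w v := by
  classical
  let p : W → lp (fun _ : ι => ℝ) 2 := fun w => ∑ v ∈ σ, c w v • lp.single 2 v (1 : ℝ)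
  have hp : ∀ w v, p w v = c w v := by
    intro w v
    simp only [p, lp.coeFn_sum, Finset.sum_apply, lp.coeFn_smul, Pi.smul_apply, lp.single_apply,
      smul_eq_mul, Pi.single_apply, mul_ite, mul_one, mul_zero, Finset.sum_ite_eq]
    split_ifs with hv
    · rfl
    · exact (hz w v hv).symm
  have hps : ∀ w, p w ∈ simplex σ := fun w =>
    ⟨fun v => (h0 w v).trans_eq (hp w v).symm, fun v hv => (hp w v).trans (hz w v hv),
      (Finset.sum_congr rfl fun v _ => hp w v).trans (h1 w)⟩
  have hpc : Continuous p := continuous_finsetSum _ fun v _ => (hc v).smul continuous_const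
  exact ⟨⟨fun w => ofSimplex K τ hσ ⟨p w, hps w⟩,
    (continuous_ofSimplex hσ).comp (hpc.subtype_mk _)⟩, hp⟩

/-- A simplex with at most `n + 1` vertices is a retract of the cube `I^n`. The map onto the simplex
sends `t` to the point with coordinates `t_i / max 1 (∑ t_j)` at all but one of the vertices. -/
theorem exists_simplex_chart {σ : Finset ι} (hσ : σ ∈ K.faces) {n : ℕ} (hn : σ.card ≤ n + 1) :
    ∃ (φ : C(Realization K τ, Cube n)) (ψ : C(Cube n, Realization K τ)),
      ∀ x : Realization K τ, x.supp ⊆ σ → ψ (φ x) = x := by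
  classical
  obtain ⟨v₀, hv₀⟩ := (K.isRelLowerSet_faces hσ).1
  have hcard : Fintype.card (σ.erase v₀) ≤ Fintype.card (Fin n) := by
    rw [Fintype.card_coe, Fintype.card_fin, Finset.card_erase_of_mem hv₀]
    omega
  obtain ⟨m⟩ := Function.Embedding.nonempty_of_card_le hcard
  let φ : C(Realization K τ, Cube n) :=
    ⟨fun x => Function.extend m (fun v => ⟨x.coord v, x.coord_nonneg v, x.coord_le_one v⟩) 0, by
      refine continuous_pi fun i => ?_
      by_cases hi : ∃ v, m v = i
      · obtain ⟨v, rfl⟩ := hi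
        simp only [m.injective.extend_apply]
        exact (continuous_coord v.1).subtype_mk _
      · simp only [Function.extend_apply' _ _ _ hi]
        exact continuous_const⟩
  have hφ : ∀ x v, (φ x (m v) : ℝ) = x.coord v := fun x v => by
    change ((Function.extend m _ 0 (m v) : unitInterval) : ℝ) = _
    rw [m.injective.extend_apply]
  let d : Cube n → ι → ℝ := fun t v => if hv : v ∈ σ.erase v₀ then t (m ⟨v, hv⟩) else 0
  have hd : ∀ v, Continuous fun t => d t v := by
    intro v
    by_cases hv : v ∈ σ.erase v₀
    · simp only [d, hv, dif_pos]
      fun_prop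
    · simp only [d, hv, dif_neg, not_false_eq_true]
      exact continuous_const
  have hd0 : ∀ t v, 0 ≤ d t v := by
    intro t v
    by_cases hv : v ∈ σ.erase v₀
    · simp only [d, hv, dif_pos]
      exact (t _).2.1
    · simp only [d, hv, dif_neg, not_false_eq_true, le_refl]
  let S : Cube n → ℝ := fun t => ∑ v ∈ σ.erase v₀, d t v
  have hS : Continuous S := continuous_finsetSum _ fun v _ => hd v
  have hS1 : ∀ t, 0 < max 1 (S t) := fun t => one_pos.trans_le (le_max_left _ _)
  let c : Cube n → ι → ℝ := fun t v =>
    if v = v₀ then 1 - S t / max 1 (S t) else d t v / max 1 (S t)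
  have hc : ∀ v, Continuous fun t => c t v := by
    intro v
    by_cases hv : v = v₀
    · simp only [c, hv, if_true]
      exact continuous_const.sub (hS.div (continuous_const.max hS) fun t => (hS1 t).ne')
    · simp only [c, hv, if_false]
      exact (hd v).div (continuous_const.max hS) fun t => (hS1 t).ne'
  have hc0 : ∀ t v, 0 ≤ c t v := by
    intro t v
    by_cases hv : v = v₀
    · simp only [c, hv, if_true, sub_nonneg]
      exact (div_le_one (hS1 t)).2 (le_max_right _ _)
    · simp only [c, hv, if_false]
      exact div_nonneg (hd0 t v) (hS1 t).le
  have hcz : ∀ t, ∀ v ∉ σ, c t v = 0 := by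
    intro t v hv
    have : v ≠ v₀ := fun h => hv (h ▸ hv₀)
    simp [c, this, d, hv]
  have hc1 : ∀ t, ∑ v ∈ σ, c t v = 1 := by
    intro t
    rw [← Finset.add_sum_erase _ _ hv₀]
    have : ∑ v ∈ σ.erase v₀, c t v = S t / max 1 (S t) := by
      rw [Finset.sum_div]
      exact Finset.sum_congr rfl fun v hv => by simp [c, (Finset.mem_erase.1 hv).1]
    rw [this]
    simp [c]
  obtain ⟨ψ, hψ⟩ := exists_map_of_coord (K := K) (τ := τ) hσ c hc hc0 hcz hc1
  refine ⟨φ, ψ, fun x hx => Realization.ext fun v => ?_⟩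
  have hdx : ∀ w ∈ σ.erase v₀, d (φ x) w = x.coord w := fun w hw => by
    simp only [d, hw, dif_pos, hφ]
  have hSx : S (φ x) = 1 - x.coord v₀ := by
    have h1 := x.sum_coord hx
    rw [← Finset.add_sum_erase _ _ hv₀] at h1
    have h2 : S (φ x) = ∑ v ∈ σ.erase v₀, x.coord v := Finset.sum_congr rfl hdx
    linarith
  have hmax : max 1 (S (φ x)) = 1 := max_eq_left (by linarith [x.coord_nonneg v₀])
  rw [hψ]
  simp only [c, hmax, div_one]
  split_ifs with hv
  · rw [hSx, hv]
    ring
  · by_cases hvσ : v ∈ σ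
    · exact hdx v (Finset.mem_erase.2 ⟨hv, hvσ⟩)
    · have h1 : v ∉ x.supp := fun h => hvσ (hx h)
      have h2 : x.coord v = 0 := by simpa [Realization.mem_supp] using h1
      rw [h2]
      simp [d, hvσ]

/-- The inclusion of the realization of a subcomplex. -/
def inclusionMap (hLK : L.faces ⊆ K.faces) (x : Realization L τ) : Realization K τ :=
  (⟨x.point, biUnion_subset_biUnion_left hLK (show carrier L from x).2⟩ : carrier K)

theorem coord_inclusionMap (hLK : L.faces ⊆ K.faces) (x : Realization L τ) (v : ι) :
    (inclusionMap hLK x).coord v = x.coord v := rfl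

theorem supp_inclusionMap (hLK : L.faces ⊆ K.faces) (x : Realization L τ) :
    (inclusionMap hLK x).supp = x.supp := by
  ext v
  rw [Realization.mem_supp, Realization.mem_supp, coord_inclusionMap]

theorem inclusionMap_injective (hLK : L.faces ⊆ K.faces) :
    Function.Injective (inclusionMap (τ := τ) hLK) := fun _ _ hxy =>
  Realization.ext fun v => congrArg (fun z : Realization K τ => z.coord v) hxy

theorem range_inclusionMap (hLK : L.faces ⊆ K.faces) :
    range (inclusionMap (τ := τ) hLK) = {x | x.supp ∈ L.faces} := by
  ext x
  constructor
  · rintro ⟨x, rfl⟩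
    rw [mem_ofPred_eq, supp_inclusionMap]
    exact x.supp_mem
  · intro hx
    exact ⟨ofSimplex L τ hx ⟨x.point, Realization.mem_simplex_iff.2 Subset.rfl⟩,
      Realization.ext fun v => rfl⟩

theorem isClosed_simplex (σ : Finset ι) : IsClosed (simplex σ) := by
  have hc : ∀ v, Continuous fun x : lp (fun _ : ι => ℝ) 2 => x v := fun v =>
    (lp.evalCLM ℝ (fun _ : ι => ℝ) 2 v).continuous
  have : simplex σ = (⋂ v, {x | 0 ≤ x v}) ∩ ((⋂ v ∈ {v | v ∉ σ}, {x | x v = 0}) ∩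
      {x | ∑ v ∈ σ, x v = 1}) := by
    ext x
    simp [simplex]
  rw [this]
  exact (isClosed_iInter fun v => isClosed_le continuous_const (hc v)).inter
    ((isClosed_biInter fun v _ => isClosed_eq (hc v) continuous_const).inter
      (isClosed_eq (continuous_finsetSum _ fun v _ => hc v) continuous_const))

theorem simplex_mono {ρ σ : Finset ι} (h : ρ ⊆ σ) : simplex ρ ⊆ simplex σ := by
  rintro x ⟨h0, hz, h1⟩
  refine ⟨h0, fun v hv => hz v fun hv' => hv (h hv'), ?_⟩
  rw [← Finset.sum_subset h fun v _ hv => hz v hv, h1]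

/-- The realization of a subcomplex is a closed subspace, for both topologies. In the weak one a
simplex of the larger complex meets the image of a closed set in a finite union of
closed subsets of its faces. -/
theorem isClosedEmbedding_inclusionMap (hLK : L.faces ⊆ K.faces) :
    IsClosedEmbedding (inclusionMap (τ := τ) hLK) := by
  classical
  cases τ
  · refine .of_continuous_injective_isClosedMap (continuous_weak_iff.2 fun σ hσ => ?_)
      (inclusionMap_injective hLK) fun C hC => isClosed_weak_iff.2 fun σ hσ => ?_
    · exact continuous_ofSimplex (hLK hσ)
    · have : ofSimplex K .weak hσ ⁻¹' (inclusionMap hLK '' C) =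
          ⋃ ρ : {ρ // ρ ∈ L.faces ∧ ρ ⊆ σ}, inclusion (simplex_mono ρ.2.2) ''
            (ofSimplex L .weak ρ.2.1 ⁻¹' C) := by
        ext p
        simp only [mem_preimage, mem_image, mem_iUnion]
        constructor
        · rintro ⟨y, hy, hyp⟩
          have hp : (ofSimplex K .weak hσ p).supp ⊆ σ := Realization.mem_simplex_iff.1 p.2
          rw [← hyp, supp_inclusionMap] at hp
          refine ⟨⟨y.supp, y.supp_mem, hp⟩,
            ⟨y.point, Realization.mem_simplex_iff.2 Subset.rfl⟩, hy, ?_⟩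
          exact Subtype.ext (congrArg Realization.point hyp)
        · rintro ⟨ρ, q, hq, rfl⟩
          exact ⟨_, hq, rfl⟩
      rw [this]
      have : Finite {ρ // ρ ∈ L.faces ∧ ρ ⊆ σ} :=
        Finite.of_injective (fun ρ => (⟨ρ.1, Finset.mem_powerset.2 ρ.2.2⟩ : σ.powerset))
          fun a b hab => Subtype.ext (congrArg (fun z : σ.powerset => z.1) hab)
      refine isClosed_iUnion_of_finite fun ρ => ?_
      have h1 : IsClosedEmbedding (inclusion (simplex_mono ρ.2.2)) :=
        IsClosedEmbedding.inclusion _ ((isClosed_simplex _).preimage continuous_subtype_val)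
      exact h1.isClosedMap _ (isClosed_weak_iff.1 hC ρ.1 ρ.2.1)
  · refine ⟨IsEmbedding.of_comp ?_ continuous_point_metric isEmbedding_point_metric, ?_⟩
    · exact isEmbedding_point_metric.continuous_iff.2 continuous_point_metric
    · rw [range_inclusionMap]
      exact isClosed_supp_mem L

end Realizations

/-! ### Parity shells -/

section Shells

/-- The union of the intervals `[k, k + 1]` over all natural numbers `k` of parity `e`. -/
def shell (e : ℕ) : Set ℝ := ⋃ k : {k : ℕ // k % 2 = e}, Icc (k : ℝ) (k + 1)

theorem isClosed_shell (e : ℕ) : IsClosed (shell e) := by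
  refine LocallyFinite.isClosed_iUnion (fun r => ?_) fun k => isClosed_Icc
  refine ⟨Iio (r + 1), Iio_mem_nhds (by linarith), ?_⟩
  refine Finite.of_injOn (f := fun k : {k : ℕ // k % 2 = e} => (k : ℕ)) (t := Iic ⌈r + 1⌉₊)
    (fun k hk => ?_) Subtype.val_injective.injOn (finite_Iic _)
  obtain ⟨x, hx, hx'⟩ := hk
  exact Nat.cast_le.1 ((hx.1.trans hx'.le).trans (Nat.le_ceil _))

theorem mem_shell_zero_or_one {r : ℝ} (hr : 0 ≤ r) : r ∈ shell 0 ∨ r ∈ shell 1 := by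
  have h1 := Nat.floor_le hr
  have h2 := (Nat.lt_floor_add_one r).le
  rcases Nat.mod_two_eq_zero_or_one ⌊r⌋₊ with h | h
  · exact Or.inl (mem_iUnion.2 ⟨⟨_, h⟩, h1, h2⟩)
  · exact Or.inr (mem_iUnion.2 ⟨⟨_, h⟩, h1, h2⟩)

open Classical in
/-- The natural number `k` of parity `e` with `r ∈ [k, k + 1]`, for `r ∈ shell e`. -/
noncomputable def shellIndex (e : ℕ) (r : ℝ) : ℕ :=
  if h : ∃ k : ℕ, k % 2 = e ∧ (k : ℝ) ≤ r ∧ r ≤ k + 1 then h.choose else 0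

theorem shellIndex_spec {e : ℕ} {r : ℝ} (hr : r ∈ shell e) :
    shellIndex e r % 2 = e ∧ (shellIndex e r : ℝ) ≤ r ∧ r ≤ shellIndex e r + 1 := by
  have h : ∃ k : ℕ, k % 2 = e ∧ (k : ℝ) ≤ r ∧ r ≤ k + 1 :=
    let ⟨k, hk⟩ := mem_iUnion.1 hr
    ⟨k, k.2, hk⟩
  rw [shellIndex, dif_pos h]
  exact h.choose_spec

theorem shellIndex_eq {e : ℕ} {r r' : ℝ} (hr : r ∈ shell e) (hr' : r' ∈ shell e)
    (hd : |r' - r| < 1) : shellIndex e r' = shellIndex e r := by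
  obtain ⟨h1, h2, h3⟩ := shellIndex_spec hr
  obtain ⟨h4, h5, h6⟩ := shellIndex_spec hr'
  rw [abs_lt] at hd
  have h7 : (shellIndex e r : ℝ) < (shellIndex e r' + 2 : ℕ) := by push_cast; linarith
  have h8 : (shellIndex e r' : ℝ) < (shellIndex e r + 2 : ℕ) := by push_cast; linarith
  rw [Nat.cast_lt] at h7 h8
  omega

/-- The index of the shell of `s a` is locally constant on the preimage of `shell e`. -/
theorem eventually_shellIndex_eq {A : Type*} [TopologicalSpace A] {s : A → ℝ} (hs : Continuous s)
    {e : ℕ} {a : A} (ha : s a ∈ shell e) :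
    ∀ᶠ b in 𝓝 a, s b ∈ shell e → shellIndex e (s b) = shellIndex e (s a) := by
  have : ∀ᶠ b in 𝓝 a, |s b - s a| < 1 := by
    have h : Continuous fun b => |s b - s a| := by fun_prop
    exact h.continuousAt.eventually (gt_mem_nhds (by simp))
  filter_upwards [this] with b hb hb' using shellIndex_eq ha hb' hb

end Shells

/-! ### Dimension of open subspaces -/

section Dimension

theorem CovDimLE.exists_shrinking {X : Type*} [TopologicalSpace X] {n : ℕ} (h : CovDimLE X n)
    {κ : Type*} [Finite κ] {U : κ → Set X} (hU : ∀ i, IsOpen (U i)) (hc : ∀ x, ∃ i, x ∈ U i) :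
    ∃ W : κ → Set X, (∀ i, IsOpen (W i)) ∧ (∀ i, W i ⊆ U i) ∧ (∀ x, ∃ i, x ∈ W i) ∧
      ∀ x, {i | x ∈ W i}.encard ≤ (n + 1 : ℕ) := by
  obtain ⟨𝒱, h𝒱, href, hord⟩ := h (range U) (finite_range U)
    (isCov_of_forall_mem (by rintro _ ⟨i, rfl⟩; exact hU i) fun x =>
      let ⟨i, hi⟩ := hc x
      ⟨U i, ⟨i, rfl⟩, hi⟩)
  have : ∀ V : 𝒱, ∃ i, (V : Set X) ⊆ U i := fun V => by
    obtain ⟨_, ⟨i, rfl⟩, hi⟩ := href V V.2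
    exact ⟨i, hi⟩
  choose idx hidx using this
  refine ⟨fun i => ⋃ V : {V : 𝒱 // idx V = i}, (V : Set X), fun i => isOpen_iUnion fun V =>
    h𝒱.1 _ V.1.2, fun i => iUnion_subset fun V => ?_, fun x => ?_, fun x => ?_⟩
  · obtain ⟨V, rfl⟩ := V
    exact hidx V
  · obtain ⟨V, hV, hx⟩ := h𝒱.exists_mem x
    exact ⟨idx ⟨V, hV⟩, mem_iUnion.2 ⟨⟨⟨V, hV⟩, rfl⟩, hx⟩⟩
  · have hsub : {i | x ∈ ⋃ V : {V : 𝒱 // idx V = i}, (V : Set X)} ⊆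
        idx '' (Subtype.val ⁻¹' {V ∈ 𝒱 | x ∈ V}) := by
      intro i hi
      obtain ⟨⟨V, rfl⟩, hx⟩ := mem_iUnion.1 hi
      exact ⟨V, ⟨V.2, hx⟩, rfl⟩
    refine (encard_le_encard hsub).trans ((encard_image_le _ _).trans ?_)
    refine le_trans (le_of_eq ?_) (hord x)
    rw [← Subtype.val_injective.encard_image]
    congr 1
    ext V
    simp [and_comm]

theorem covDimLE_of_exists_shrinking {X : Type u} [TopologicalSpace X] {n : ℕ}
    (h : ∀ (κ : Type u) [Finite κ] (U : κ → Set X), (∀ i, IsOpen (U i)) → (∀ x, ∃ i, x ∈ U i) →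
      ∃ W : κ → Set X, (∀ i, IsOpen (W i)) ∧ (∀ i, W i ⊆ U i) ∧ (∀ x, ∃ i, x ∈ W i) ∧
        ∀ x, {i | x ∈ W i}.encard ≤ (n + 1 : ℕ)) : CovDimLE X n := by
  intro 𝒰 hfin h𝒰
  have : Finite 𝒰 := hfin
  obtain ⟨W, hW, hWU, hWc, hord⟩ := h 𝒰 (fun U => (U : Set X)) (fun U => h𝒰.1 U U.2) fun x =>
    let ⟨U, hU, hx⟩ := h𝒰.exists_mem x
    ⟨⟨U, hU⟩, hx⟩
  refine ⟨range W, isCov_of_forall_mem (by rintro _ ⟨i, rfl⟩; exact hW i) fun x =>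
    let ⟨i, hi⟩ := hWc x
    ⟨W i, ⟨i, rfl⟩, hi⟩, ?_, fun x => ?_⟩
  · rintro _ ⟨U, rfl⟩
    exact ⟨U, U.2, hWU U⟩
  · have hsub : {V ∈ range W | x ∈ V} ⊆ W '' {i | x ∈ W i} := by
      rintro _ ⟨⟨i, rfl⟩, hx⟩
      exact ⟨i, hx, rfl⟩
    exact (encard_le_encard hsub).trans ((encard_image_le _ _).trans (hord x))

/-- Open subspaces of metrizable spaces carry a continuous function with values in `[0, ∞)` whose
sublevel sets are closed in the whole space. -/
theorem exists_exhaustion {Y : Type*} [TopologicalSpace Y] [TopologicalSpace.MetrizableSpace Y]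
    {V : Set Y} (hV : IsOpen V) : ∃ s : C(V, ℝ), (∀ x, 0 ≤ s x) ∧
      ∀ c : ℝ, 0 < c → IsClosed ((↑) '' {x : V | s x ≤ c} : Set Y) := by
  let := TopologicalSpace.metrizableSpaceMetric Y
  rcases eq_empty_or_nonempty Vᶜ with hE | hne
  · refine ⟨0, fun x => le_rfl, fun c hc => ?_⟩
    have hVu : V = univ := compl_empty_iff.1 hE
    have : (↑) '' {x : V | (0 : C(V, ℝ)) x ≤ c} = (univ : Set Y) := by
      ext y
      simp [hc.le, hVu]
    rw [this]
    exact isClosed_univ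
  have hpos : ∀ y, 0 < Metric.infDist y Vᶜ ↔ y ∈ V := fun y => by
    rw [← hV.isClosed_compl.notMem_iff_infDist_pos hne, notMem_compl_iff]
  have hδ : Continuous fun y => Metric.infDist y Vᶜ := Metric.continuous_infDist_pt _
  refine ⟨⟨fun x => 1 / Metric.infDist (x : Y) Vᶜ, continuous_const.div
    (hδ.comp continuous_subtype_val) fun x => ((hpos x).2 x.2).ne'⟩,
    fun x => div_nonneg zero_le_one Metric.infDist_nonneg, fun c hc => ?_⟩
  have : (↑) '' {x : V | 1 / Metric.infDist (x : Y) Vᶜ ≤ c} =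
      {y : Y | 1 ≤ c * Metric.infDist y Vᶜ} := by
    ext y
    constructor
    · rintro ⟨x, hx, rfl⟩
      exact (div_le_iff₀ ((hpos x).2 x.2)).1 hx
    · intro hy
      have h0 : 0 < Metric.infDist y Vᶜ :=
        pos_of_mul_pos_right (one_pos.trans_le hy) hc.le
      exact ⟨⟨y, (hpos y).1 h0⟩, (div_le_iff₀ h0).2 hy, rfl⟩
  change IsClosed ((↑) '' {x : V | 1 / Metric.infDist (x : Y) Vᶜ ≤ c} : Set Y)
  rw [this]
  exact isClosed_le continuous_const (continuous_const.mul hδ)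

/-- The dimension does not increase under passage to an open subspace `V` of a metrizable space.
The subspace is the union of two closed sets, consisting of even and of odd shells, and each
cover can be shrunk over each of them to one of the required order. -/
theorem CovDimLE.of_isOpen {Y : Type u} [TopologicalSpace Y] [TopologicalSpace.MetrizableSpace Y]
    {n : ℕ} (h : CovDimLE Y n) {V : Set Y} (hV : IsOpen V) : CovDimLE V n := by
  obtain ⟨s, hs0, hsc⟩ := exists_exhaustion hV
  have step : ∀ (e : ℕ) (κ : Type u) [Finite κ] (U : κ → Set V), (∀ i, IsOpen (U i)) →
      (∀ x, ∃ i, x ∈ U i) → ∃ W : κ → Set V, (∀ i, IsOpen (W i)) ∧ (∀ i, W i ⊆ U i) ∧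
        (∀ x, ∃ i, x ∈ W i) ∧ ∀ x, s x ∈ shell e → {i | x ∈ W i}.encard ≤ (n + 1 : ℕ) := by
    intro e κ _ U hU hUc
    have hk : ∀ k : ℕ, ∃ G : κ → Set V, (∀ i, IsOpen (G i)) ∧
        (∀ x, s x ≤ k + 1 → ∃ i, x ∈ G i) ∧ (∀ i, G i ⊆ U i) ∧
        ∀ x, {i | x ∈ G i}.encard ≤ (n + 1 : ℕ) := by
      intro k
      let F : Set Y := (↑) '' {x : V | s x ≤ k + 1}
      have hopen : ∀ o : Option κ, IsOpen (o.elim Fᶜ fun i => ((↑) '' U i : Set Y))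
        | none => (hsc _ (by positivity)).isOpen_compl
        | some i => hV.isOpenMap_subtype_val _ (hU i)
      have hcov : ∀ y, ∃ o : Option κ, y ∈ o.elim Fᶜ fun i => ((↑) '' U i : Set Y) := by
        intro y
        by_cases hy : y ∈ F
        · obtain ⟨x, hx, rfl⟩ := hy
          obtain ⟨i, hi⟩ := hUc x
          exact ⟨some i, x, hi, rfl⟩
        · exact ⟨none, hy⟩
      obtain ⟨W, hW, hWU, hWc, hord⟩ := h.exists_shrinking hopen hcov
      refine ⟨fun i => (↑) ⁻¹' W (some i), fun i => (hW _).preimage continuous_subtype_val,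
        fun x hx => ?_, fun i x hx => ?_, fun x => ?_⟩
      · obtain ⟨o, ho⟩ := hWc x
        cases o with
        | none => exact absurd ⟨x, hx, rfl⟩ (hWU none ho)
        | some i => exact ⟨i, ho⟩
      · obtain ⟨x', hx', hxx'⟩ := hWU (some i) hx
        rwa [← Subtype.ext hxx']
      · have : (some '' {i | x ∈ ((↑) ⁻¹' W (some i) : Set V)}) ⊆ {o | (x : Y) ∈ W o} := by
          rintro _ ⟨i, hi, rfl⟩
          exact hi
        rw [← (Option.some_injective κ).encard_image]
        exact (encard_le_encard this).trans (hord x)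
    choose G hG hGc hGU hGord using hk
    refine ⟨fun i => {x | x ∈ U i ∧ (s x ∈ shell e → x ∈ G (shellIndex e (s x)) i)},
      fun i => isOpen_iff_mem_nhds.2 fun x hx => ?_, fun i x hx => hx.1, fun x => ?_,
      fun x hx => ?_⟩
    · by_cases hxe : s x ∈ shell e
      · filter_upwards [(hU i).mem_nhds hx.1, eventually_shellIndex_eq s.continuous hxe,
          (hG _ i).mem_nhds (hx.2 hxe)] with z h1 h2 h3
        refine ⟨h1, fun hz => ?_⟩
        rw [h2 hz]
        exact h3
      · have : ∀ᶠ z in 𝓝 x, s z ∉ shell e :=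
          s.continuous.continuousAt.eventually ((isClosed_shell e).isOpen_compl.mem_nhds hxe)
        filter_upwards [(hU i).mem_nhds hx.1, this] with z h1 h2
        exact ⟨h1, fun hz => absurd hz h2⟩
    · by_cases hxe : s x ∈ shell e
      · obtain ⟨i, hi⟩ := hGc _ x (shellIndex_spec hxe).2.2
        exact ⟨i, hGU _ i hi, fun _ => hi⟩
      · obtain ⟨i, hi⟩ := hUc x
        exact ⟨i, hi, fun hx => absurd hx hxe⟩
    · exact (encard_le_encard fun i hi => hi.2 hx).trans (hGord (shellIndex e (s x)) x)
  refine covDimLE_of_exists_shrinking fun κ _ U hU hUc => ?_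
  obtain ⟨W, hW, hWU, hWc, hord⟩ := step 0 κ U hU hUc
  obtain ⟨W', hW', hWU', hWc', hord'⟩ := step 1 κ W hW hWc
  refine ⟨W', hW', fun i => (hWU' i).trans (hWU i), hWc', fun x => ?_⟩
  rcases mem_shell_zero_or_one (hs0 x) with hx | hx
  · exact (encard_le_encard fun i hi => hWU' i hi).trans (hord x hx)
  · exact hord' x hx

theorem covDim_le_of_isOpen {Y : Type u} [TopologicalSpace Y] [TopologicalSpace.MetrizableSpace Y]
    {V : Set Y} (hV : IsOpen V) : covDim V ≤ covDim Y := by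
  rcases isEmpty_or_nonempty V with hE | hne
  · simp [covDim, hE]
  · have hY : ¬ IsEmpty Y := fun h => hne.elim fun x => h.elim x
    rw [covDim, covDim, if_neg (not_isEmpty_iff.2 hne), if_neg hY]
    exact WithBot.coe_le_coe.2 (le_iInf₂ fun n hn => iInf₂_le n (hn.of_isOpen hV))

end Dimension

/-! ### Cardinal invariants -/

section Cardinals

theorem comp_le_succ (X : Type u) [TopologicalSpace X] :
    comp X ≤ max ℵ₀ (Order.succ #(Set X)) :=
  csInf_le' ⟨le_max_left _ _, fun 𝒰 h𝒰 => ⟨𝒰, Subset.rfl, h𝒰.2,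
    (Cardinal.mk_set_le 𝒰).trans_lt ((Order.lt_succ _).trans_le (le_max_right _ _))⟩⟩

theorem aleph0_le_comp (X : Type u) [TopologicalSpace X] : ℵ₀ ≤ comp X :=
  le_csInf ⟨max ℵ₀ (Order.succ #(Set X)), le_max_left _ _, fun 𝒰 h𝒰 => ⟨𝒰, Subset.rfl, h𝒰.2,
    (Cardinal.mk_set_le 𝒰).trans_lt ((Order.lt_succ _).trans_le (le_max_right _ _))⟩⟩
    fun _ h => h.1

theorem aleph0_le_compLoc (Y : Type u) [TopologicalSpace Y] : ℵ₀ ≤ compLoc Y := by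
  refine le_csInf ⟨max ℵ₀ (Order.succ #(Set Y)), le_max_left _ _, fun y => ⟨univ,
    Filter.univ_mem, (comp_le_succ _).trans ?_⟩⟩ fun _ h => h.1
  rw [Cardinal.mk_congr (Equiv.Set.congr (Equiv.Set.univ Y))]

theorem comp_le_aleph0 (X : Type u) [TopologicalSpace X] [CompactSpace X] : comp X ≤ ℵ₀ := by
  refine csInf_le' ⟨le_rfl, fun 𝒰 h𝒰 => ?_⟩
  obtain ⟨t, ht, hc⟩ := isCompact_univ.elim_finite_subcover_image (b := 𝒰) (c := fun s => s) h𝒰.1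
    (by rw [← sUnion_eq_biUnion, h𝒰.2])
  refine ⟨t, ht, eq_univ_of_univ_subset ?_, Cardinal.lt_aleph0_iff_set_finite.2 hc.1⟩
  rw [sUnion_eq_biUnion]
  exact hc.2

theorem compLoc_le_aleph0 (Y : Type u) [TopologicalSpace Y] [LocallyCompactSpace Y] :
    compLoc Y ≤ ℵ₀ := by
  refine csInf_le' ⟨le_rfl, fun y => ?_⟩
  obtain ⟨F, hF, hy⟩ := exists_compact_mem_nhds y
  have := isCompact_iff_compactSpace.1 hF
  exact ⟨F, hy, comp_le_aleph0 F⟩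

variable {T : Set TopCat.{u}} {Y X : Type u} [TopologicalSpace Y] [TopologicalSpace X]

theorem min_comp_le_compMeet (hX : TopCat.of X ∈ T) : min (comp X) (compLoc Y) ≤ compMeet T Y := by
  refine le_csSup ⟨compLoc Y, ?_⟩ ⟨TopCat.of X, hX, rfl⟩
  rintro _ ⟨Z, -, rfl⟩
  exact min_le_right _ _

theorem mk_finset_lt_compMeet (hX : TopCat.of X ∈ T) {ι : Type u} (hι : #ι < compMeet T Y) :
    #(Finset ι) < compMeet T Y := by
  rcases finite_or_infinite ι with h | h
  · exact (Cardinal.lt_aleph0_of_finite _).trans_le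
      ((le_min (aleph0_le_comp X) (aleph0_le_compLoc Y)).trans (min_comp_le_compMeet hX))
  · rwa [Cardinal.mk_finset_of_infinite]

variable {ι : Type u} {K : AbstractSimplicialComplex ι}

/-- A finite dimensional complex with nonempty realization has a well-defined dimension `m ∈ ℕ`. -/
theorem FiniteDimensional.exists_dim (hK : FiniteDimensional K) (hne : K.faces.Nonempty) :
    ∃ m : ℕ, (m : WithBot ℕ∞) ≤ complexDim K ∧ ∀ σ ∈ K.faces, σ.card ≤ m + 1 := by
  obtain ⟨N, hN⟩ := hK
  have hfin : (Finset.card '' K.faces).Finite := (finite_Iic N).subset (by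
    rintro _ ⟨σ, hσ, rfl⟩
    exact hN σ hσ)
  obtain ⟨_, ⟨σ, hσ, rfl⟩, hmax⟩ := hfin.exists_maximal (hne.image _)
  refine ⟨σ.card - 1, le_iSup₂_of_le σ hσ le_rfl, fun ρ hρ => ?_⟩
  have h1 : ρ.card ≤ σ.card := by
    by_contra! hlt
    exact absurd (hmax ⟨ρ, hρ, rfl⟩ hlt.le) (not_le.2 hlt)
  omega

theorem Witnesses.complexDim_le [TopologicalSpace.MetrizableSpace Y] {V : Set Y} (hV : IsOpen V)
    (hX : TopCat.of X ∈ T) {f : C(X, V)} {𝒰 : Set (Set Y)} (hW : Witnesses K V f 𝒰) :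
    complexDim K ≤ dimMeet T Y :=
  hW.dim_le.trans <| (min_le_min le_rfl (covDim_le_of_isOpen hV)).trans <|
    le_sSup ⟨TopCat.of X, hX, rfl⟩

theorem Witnesses.mk_lt_compMeet {V : Set Y} (hV : comp (closure V) ≤ compLoc Y)
    (hX : TopCat.of X ∈ T) {f : C(X, V)} {𝒰 : Set (Set Y)} (hW : Witnesses K V f 𝒰) :
    #ι < compMeet T Y :=
  hW.card_lt.trans_le ((min_le_min le_rfl hV).trans (min_comp_le_compMeet hX))

end Cardinals

/-! ### Model spaces -/

section Models

variable {Y : Type u} [TopologicalSpace Y]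

/-- Up to homeomorphism, `S` belongs to the class `T` and all maps from `S` to `Y` are limits of
members of the system. -/
def HasApprox (T : Set TopCat.{u}) (D : ∀ X : TopCat.{u}, Set C(X, Y)) (S : Type*)
    [TopologicalSpace S] : Prop :=
  ∃ (P : Type u) (_ : TopologicalSpace P), TopCat.of P ∈ T ∧ Nonempty (P ≃ₜ S) ∧
    ∀ f : C(P, Y), Approx D f

/-- A map into a disjoint union is continuous if its index is locally constant and it is continuous
after composition with inducing maps into a common space. -/
theorem continuous_of_isInducing_sigma {A κ W : Type*} {S : κ → Type*} [TopologicalSpace A]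
    [∀ i, TopologicalSpace (S i)] [TopologicalSpace W] {c : ∀ i, S i → W}
    (hc : ∀ i, IsInducing (c i)) {F : A → Σ i, S i}
    (h₁ : ∀ a, ∀ᶠ b in 𝓝 a, (F b).1 = (F a).1) (h₂ : Continuous fun a => c (F a).1 (F a).2) :
    Continuous F := by
  rw [continuous_iff_continuousAt]
  intro a
  have hF : 𝓝 (F a) = Filter.map (Sigma.mk (F a).1) (𝓝 (F a).2) := Sigma.nhds_mk _ _
  rw [ContinuousAt, hF, (hc _).nhds_eq_comap]
  intro U hU
  obtain ⟨V, hV, hVU⟩ := hU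
  change F ⁻¹' U ∈ 𝓝 a
  filter_upwards [h₁ a, h₂.continuousAt.preimage_mem_nhds hV] with b hb hbV
  have : ∀ z : Σ i, S i, z.1 = (F a).1 → c z.1 z.2 ∈ V → z ∈ U := by
    rintro ⟨i, z⟩ hi hz
    obtain rfl : i = (F a).1 := hi
    exact hVU hz
  exact this _ hb hbV

variable {T : Set TopCat.{u}} {D : ∀ X : TopCat.{u}, Set C(X, Y)}

namespace IsSetting

variable (h : IsSetting T D) {X : Type u} [TopologicalSpace X]

include h

theorem hasApprox_of_isClosedEmbedding {S S' : Type*} [TopologicalSpace S] [TopologicalSpace S']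
    (hS : HasSMAPAt T D S) {i : S' → S} (hi : IsClosedEmbedding i) : HasApprox T D S' := by
  obtain ⟨Z, hZ, ⟨e⟩, hs⟩ := hS
  have hj : IsClosedEmbedding (e.symm ∘ i) := e.symm.isClosedEmbedding.comp hi
  exact ⟨range (e.symm ∘ i), inferInstance, h.of_isClosed (X := Z) hZ hj.isClosed_range,
    ⟨hj.isEmbedding.toHomeomorph.symm⟩,
    h.approx_of_smap (P := Z) (h.of_isClosed (X := Z) hZ hj.isClosed_range) hZ
      hj.isClosed_range.isClosedEmbedding_subtypeVal hs⟩

theorem approxOn_of_hasApprox (hX : TopCat.of X ∈ T) {A : Set X} (hA : IsClosed A) {S : Type*}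
    [TopologicalSpace S] (hS : HasApprox T D S) (φ : C(A, S)) {f : C(X, Y)} (ψ : C(S, Y))
    (hφ : ∀ a, ψ (φ a) = f a) : ApproxOn D f A := by
  obtain ⟨P, _, hP, ⟨e⟩, hPa⟩ := hS
  exact h.approxOn_of_factor hX hA hP ((e.symm : C(S, P)).comp φ) (ψ.comp (e : C(P, S))) (hPa _)
    fun a => by simp [hφ]

theorem approx_of_isEmpty (hX : TopCat.of X ∈ T) [IsEmpty X] (f : C(X, Y)) : Approx D f :=
  fun _ h𝒰 => ⟨f, h.mem_of_isEmpty hX f, h𝒰.close_refl f⟩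

theorem approxOn_empty (hX : TopCat.of X ∈ T) (f : C(X, Y)) : ApproxOn D f ∅ :=
  h.approxOn_of_restrict hX isClosed_empty
    (h.approx_of_isEmpty (h.of_isClosed hX isClosed_empty) _)

/-- By transitivity, the factorizations through polyhedra supplied by corelatedness reduce
approximation of all maps to approximation of maps defined on these polyhedra. -/
theorem approx_of_corelated {τ : ComplexTopology} (hTY : Corelated τ T Y) (hX : TopCat.of X ∈ T)
    (hpoly : ∀ (ι : Type u) (K : AbstractSimplicialComplex ι) (Z : Type u) [TopologicalSpace Z],
      TopCat.of Z ∈ T → (Z ≃ₜ Realization K τ) → #ι < comp X → #ι < compLoc Y →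
      #ι < compMeet T Y → complexDim K ≤ dimMeet T Y → LocallyFiniteDimensional K →
      (FDT X ∨ LocallyFDT Y → FiniteDimensional K) → ∀ f : C(Z, Y), Approx D f)
    (f : C(X, Y)) : Approx D f := by
  have := h.isANR.1
  obtain ⟨𝒱, h𝒱, hV⟩ := hTY.2 _ hX
  refine h.approx_of_small hX hX .id h𝒱 (fun f ⟨V, hVm, hfV⟩ 𝒰 h𝒰 => ?_) f
  obtain ⟨hcomp, hfdt, hfac⟩ := hV V hVm
  obtain ⟨𝒰', h𝒰', htr⟩ := h𝒰.exists_half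
  obtain ⟨ι, K, hW, Z, hZ, ⟨e⟩⟩ := hfac
    ⟨fun x => ⟨f x, hfV (subset_closure (mem_range_self x))⟩, f.continuous.subtype_mk _⟩ 𝒰' h𝒰'
  obtain ⟨v, w, hvw⟩ := hW.approx
  obtain ⟨g, hg, hwg⟩ := hpoly ι K Z hZ e (hW.card_lt.trans_le (min_le_left _ _))
    (hW.card_lt.trans_le ((min_le_right _ _).trans hcomp)) (hW.mk_lt_compMeet hcomp hX)
    (hW.complexDim_le (h𝒱.1 V hVm) hX) hW.locallyFiniteDimensional
    (fun hF => hW.finiteDimensional (hF.imp_right hfdt))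
    ((w.comp (idToMetric K τ)).comp (e : C(Z, Realization K τ))) 𝒰' h𝒰'
  let v' : C(X, Z) := (e.symm : C(Realization K τ, Z)).comp ((idOfWeak K τ).comp v)
  refine ⟨g.comp v', h.comp_mem hX hZ v' hg, htr hvw fun x => ?_⟩
  obtain ⟨U, hU, h1, h2⟩ := hwg (v' x)
  refine ⟨U, hU, ?_, h2⟩
  have h3 : e (v' x) = idOfWeak K τ (v x) := e.apply_symm_apply _
  have h4 : w (idToMetric K τ (e (v' x))) ∈ U := h1
  rw [h3] at h4
  exact h4

end IsSetting

end Models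

/-! ### Approximation of maps on polyhedra -/

section Polyhedra

variable {Y : Type u} [TopologicalSpace Y] {T : Set TopCat.{u}}
  {D : ∀ X : TopCat.{u}, Set C(X, Y)} {ι : Type u} {K : AbstractSimplicialComplex ι}
  {τ : ComplexTopology} {Z : Type u} [TopologicalSpace Z]

/-- The `(n-1)`-skeleton of a complex, whose faces have at most `n` vertices. -/
def skeleton (K : AbstractSimplicialComplex ι) (n : ℕ+) : AbstractSimplicialComplex ι where
  faces := {σ ∈ K.faces | σ.card ≤ n}
  isRelLowerSet_faces := fun _ hσ => ⟨(K.isRelLowerSet_faces hσ.1).1, fun _ hρσ hρ =>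
    ⟨(K.isRelLowerSet_faces hσ.1).2 hρσ hρ, (Finset.card_le_card hρσ).trans hσ.2⟩⟩
  singleton_mem v := ⟨K.singleton_mem v, n.2⟩

theorem skeleton_subset_complexJ (e : ι) (n : ℕ+) :
    (skeleton K n).faces ⊆ (complexJ e n).faces := by
  rintro σ ⟨hσ, hn⟩
  refine ⟨(K.isRelLowerSet_faces hσ).1, (encard_insert_le _ _).trans ?_⟩
  rw [encard_coe_eq_coe_finsetCard]
  gcongr

/-- On a locally finite dimensional complex there is a continuous function which bounds from above
the number of vertices of the simplex carrying a given point. -/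
theorem exists_card_supp_le (hK : LocallyFiniteDimensional K) :
    ∃ s : C(Realization K .metric, ℝ), ∀ x, (x.supp.card : ℝ) ≤ s x := by
  have : NormalSpace (Realization K .metric) := inferInstanceAs (NormalSpace (carrier K))
  have : ParacompactSpace (Realization K .metric) := inferInstanceAs (ParacompactSpace (carrier K))
  refine exists_continuous_forall_mem_convex_of_local_const
    (t := fun x : Realization K .metric => {c : ℝ | (x.supp.card : ℝ) ≤ c})
    (fun x => convex_Ici _) fun x => ?_
  obtain ⟨v, hv⟩ := x.supp_nonempty
  obtain ⟨n, hn⟩ := hK v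
  refine ⟨n, ?_⟩
  filter_upwards [eventually_supp_subset x] with y hy
  exact Nat.cast_le.2 (hn _ y.supp_mem (hy hv))

namespace IsSetting

variable (h : IsSetting T D)

include h

/-- Maps on finite polyhedra: each simplex is a closed subspace and a retract of a cube. -/
theorem approx_of_finite (hZ : TopCat.of Z ∈ T) (e : Z ≃ₜ Realization K τ) [Finite ι] {n : ℕ}
    (hn : ∀ σ ∈ K.faces, σ.card ≤ n + 1) (hcube : HasSMAPAt T D (Cube n)) (f : C(Z, Y)) :
    Approx D f := by
  classical
  have hcl : ∀ s : Finset (Finset ι), IsClosed {z : Z | ∃ σ ∈ s, (e z).supp ⊆ σ} := by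
    intro s
    have : {z : Z | ∃ σ ∈ s, (e z).supp ⊆ σ} = ⋃ σ ∈ s, e ⁻¹' {x | x.supp ⊆ σ} := by
      ext z
      simp
    rw [this]
    exact isClosed_biUnion_finset fun σ _ => (isClosed_supp_subset σ).preimage e.continuous
  have key : ∀ s : Finset (Finset ι), (∀ σ ∈ s, σ ∈ K.faces) →
      ∀ f : C(Z, Y), ApproxOn D f {z : Z | ∃ σ ∈ s, (e z).supp ⊆ σ} := by
    intro s
    induction s using Finset.induction_on with
    | empty =>
      intro _ f
      convert h.approxOn_empty hZ f using 1
      ext z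
      simp
    | insert σ s hσs ih =>
      intro hs f
      have hσ := hs σ (Finset.mem_insert_self _ _)
      have : {z : Z | ∃ ρ ∈ insert σ s, (e z).supp ⊆ ρ} =
          {z : Z | ∃ ρ ∈ s, (e z).supp ⊆ ρ} ∪ {z | (e z).supp ⊆ σ} := by
        ext z
        simp [or_comm]
      rw [this]
      have hA : IsClosed {z | (e z).supp ⊆ σ} := (isClosed_supp_subset σ).preimage e.continuous
      refine h.approxOn_union hZ (hcl s) hA
        (ih (fun ρ hρ => hs ρ (Finset.mem_insert_of_mem hρ)) f)
        isCov_univ fun f' _ => ?_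
      obtain ⟨φ, ψ, hφψ⟩ := exists_simplex_chart (τ := τ) hσ (hn σ hσ)
      refine h.approxOn_of_hasApprox hZ hA (h.hasApprox_of_isClosedEmbedding hcube .id)
        ⟨fun a => φ (e a), φ.continuous.comp (e.continuous.comp continuous_subtype_val)⟩
        ⟨fun t => f' (e.symm (ψ t)), f'.continuous.comp (e.symm.continuous.comp ψ.continuous)⟩
        fun a => ?_
      change f' (e.symm (ψ (φ (e a)))) = f' a
      rw [hφψ _ a.2, e.symm_apply_apply]
  have hfin := Fintype.ofFinite ι
  refine h.approx_of_approxOn_univ hZ ?_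
  convert key {σ | σ ∈ K.faces} (fun σ hσ => by simpa using hσ) f using 1
  ext z
  simp only [mem_univ, mem_ofPred_eq, true_iff]
  exact ⟨(e z).supp, by simpa using (e z).supp_mem, Subset.rfl⟩

/-- Maps on finite dimensional polyhedra. By strong normality an approximation on a skeleton belongs
to the system on a neighbourhood of the skeleton, and outside of this neighbourhood
the next skeleton is a discrete union of closed subsets of simplices. -/
theorem approx_of_finiteDimensional (hstrong : StrongAxiom Y T D) (hZ : TopCat.of Z ∈ T)
    (e : Z ≃ₜ Realization K τ) {n : ℕ} (hn : ∀ σ ∈ K.faces, σ.card ≤ n + 1)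
    (hcube : ∀ (α : Type u) [Nonempty α] [TopologicalSpace α] [DiscreteTopology α],
      #α ≤ #(Finset ι) → ∃ m ≥ n, HasSMAPAt T D (Cube m × α)) (f : C(Z, Y)) : Approx D f := by
  have hcl : ∀ k, IsClosed {z : Z | (e z).supp.card ≤ k} := fun k =>
    (isClosed_card_supp_le k).preimage e.continuous
  have key : ∀ k, ∀ f : C(Z, Y), ApproxOn D f {z : Z | (e z).supp.card ≤ k} := by
    intro k
    induction k with
    | zero =>
      intro f
      convert h.approxOn_empty hZ f using 1
      ext z
      simpa using (e z).supp_nonempty.ne_empty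
    | succ k ih =>
      intro f
      let α : Type u := {σ : Finset ι // σ ∈ K.faces ∧ σ.card = k + 1}
      rcases isEmpty_or_nonempty α with hα | hα
      · convert ih f using 1
        ext z
        refine ⟨fun hz => ?_, fun hz => hz.trans (Nat.le_succ k)⟩
        by_contra hlt
        exact hα.elim ⟨(e z).supp, (e z).supp_mem, le_antisymm hz (Nat.succ_le_of_lt (not_le.1 hlt))⟩
      let : TopologicalSpace α := ⊥
      have : DiscreteTopology α := ⟨rfl⟩
      obtain ⟨m, hnm, hsm⟩ := hcube α (Cardinal.mk_subtype_le _)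
      have hchart : ∀ σ : α, ∃ (φ : C(Realization K τ, Cube m)) (ψ : C(Cube m, Realization K τ)),
          ∀ x : Realization K τ, x.supp ⊆ σ.1 → ψ (φ x) = x := fun σ =>
        exists_simplex_chart σ.2.1 ((hn _ σ.2.1).trans (by omega))
      choose φ ψ hφψ using hchart
      have happ : HasApprox T D (Cube m × α) := h.hasApprox_of_isClosedEmbedding hsm .id
      intro 𝒰 h𝒰
      have := h.isANR.1
      obtain ⟨𝒰', h𝒰', htr⟩ := h𝒰.exists_half
      obtain ⟨g₁, hfg₁, hg₁⟩ := ih f 𝒰' h𝒰'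
      obtain ⟨N, hN, hg₁N, hkN⟩ := hstrong _ hZ _ (hcl k) g₁ hg₁
      let C : Set Z := {z | (e z).supp.card ≤ k + 1} \ interior N
      have hC : IsClosed C := (hcl (k + 1)).sdiff isOpen_interior
      have hCcard : ∀ z ∈ C, (e z).supp.card = k + 1 := fun z hz =>
        le_antisymm hz.1 (Nat.succ_le_of_lt (not_le.1 fun hk => hz.2 (hkN hk)))
      let σ : C → α := fun z => ⟨(e z).supp, (e z).supp_mem, hCcard z z.2⟩
      have hσ : ∀ z, ∀ᶠ z' in 𝓝 z, σ z' = σ z := by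
        intro z
        have h1 : Continuous fun z : C => e z := e.continuous.comp continuous_subtype_val
        filter_upwards [h1.continuousAt.eventually (eventually_supp_subset (e z))] with z' hz'
        refine Subtype.ext (Finset.eq_of_subset_of_card_le hz' ?_).symm
        rw [hCcard z z.2, hCcard z' z'.2]
      let Φ : C(C, Cube m × α) := ⟨fun z => (φ (σ z) (e z), σ z), by
        rw [continuous_iff_continuousAt]
        intro z
        have h1 : Continuous fun z' : C => (φ (σ z) (e z'), σ z) := by fun_prop
        refine h1.continuousAt.congr ?_
        filter_upwards [hσ z] with z' hz'
        rw [hz']⟩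
      have hgC : ApproxOn D g₁ (N ∪ C) := by
        refine h.approxOn_union hZ hN hC (fun 𝒲 h𝒲 => ⟨g₁, h𝒲.close_refl _, hg₁N⟩)
          isCov_univ fun f' _ => ?_
        refine h.approxOn_of_hasApprox hZ hC happ Φ
          ⟨fun p => f' (e.symm (ψ p.2 p.1)), f'.continuous.comp (e.symm.continuous.comp
            (continuous_prod_of_discrete_right.2 fun σ => (ψ σ).continuous))⟩ fun z => ?_
        change f' (e.symm (ψ (σ z) (φ (σ z) (e z)))) = f' z
        rw [hφψ (σ z) (e z) Subset.rfl, e.symm_apply_apply]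
      obtain ⟨g₂, hg₁₂, hg₂⟩ := h.approxOn_mono hZ (hcl (k + 1)) (hN.union hC) (fun z hz => by
        by_cases hzN : z ∈ interior N
        exacts [Or.inl (interior_subset hzN), Or.inr ⟨hz, hzN⟩]) hgC 𝒰' h𝒰'
      exact ⟨g₂, htr hfg₁ hg₁₂, hg₂⟩
  refine h.approx_of_approxOn_univ hZ ?_
  convert key (n + 1) f using 1
  ext z
  simpa using hn _ (e z).supp_mem

/-- Maps on locally finite dimensional polyhedra. The polyhedron is the union of two closed sets,
the even and the odd shells of a function bounding the local dimension. Each of them is a disjoint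
union of closed subsets of skeleta, and hence factors through the space `J`. -/
theorem approx_of_locallyFiniteDimensional (hZ : TopCat.of Z ∈ T)
    (e : Z ≃ₜ Realization K τ) (hK : LocallyFiniteDimensional K) (v : ι)
    (hJ : HasSMAPAt T D (SpaceJ v τ)) (f : C(Z, Y)) : Approx D f := by
  obtain ⟨s, hs⟩ := exists_card_supp_le hK
  let s' : Z → ℝ := fun z => s (idToMetric K τ (e z))
  have hs' : Continuous s' := by fun_prop
  have hs'' : ∀ z, ((e z).supp.card : ℝ) ≤ s' z := fun z => hs (idToMetric K τ (e z))
  let S : Type u := Σ n : ℕ+, Realization (skeleton K n) τ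
  have hKn : ∀ n, (skeleton K n).faces ⊆ K.faces := fun n σ hσ => hσ.1
  let i : S → SpaceJ v τ :=
    Sigma.map id fun n => inclusionMap (skeleton_subset_complexJ (K := K) v n)
  have hi : IsClosedEmbedding i := by
    refine ⟨(isEmbedding_sigmaMap Function.injective_id).2 fun n =>
      (isClosedEmbedding_inclusionMap _).isEmbedding, isClosed_sigma_iff.2 fun n => ?_⟩
    have : Sigma.mk n ⁻¹' range i =
        range (inclusionMap (τ := τ) (skeleton_subset_complexJ (K := K) v n)) := by
      ext x
      constructor
      · rintro ⟨⟨m, y⟩, hy⟩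
        obtain ⟨rfl, hy⟩ := Sigma.mk.inj_iff.1 hy
        exact ⟨y, eq_of_heq hy⟩
      · rintro ⟨y, rfl⟩
        exact ⟨⟨n, y⟩, rfl⟩
    rw [this]
    exact (isClosedEmbedding_inclusionMap _).isClosed_range
  have hS := h.hasApprox_of_isClosedEmbedding hJ hi
  have hA : ∀ p, IsClosed {z | s' z ∈ shell p} := fun p => (isClosed_shell p).preimage hs'
  have key : ∀ p, ∀ f : C(Z, Y), ApproxOn D f {z | s' z ∈ shell p} := by
    intro p f
    let n : {z | s' z ∈ shell p} → ℕ+ := fun z => ⟨shellIndex p (s' z) + 1, Nat.succ_pos _⟩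
    have hn : ∀ z : {z | s' z ∈ shell p}, (e z).supp ∈ (skeleton K (n z)).faces := by
      intro z
      refine ⟨(e z).supp_mem, ?_⟩
      have h1 := (hs'' z).trans (shellIndex_spec z.2).2.2
      exact_mod_cast h1
    let Φ : {z | s' z ∈ shell p} → S := fun z =>
      ⟨n z, ofSimplex _ τ (hn z) ⟨(e z).point, Realization.mem_simplex_iff.2 Subset.rfl⟩⟩
    have hΦi : ∀ z, inclusionMap (hKn (Φ z).1) (Φ z).2 = e z := fun z => rfl
    have hΦ : Continuous Φ := by
      refine continuous_of_isInducing_sigma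
        (fun n => (isClosedEmbedding_inclusionMap (τ := τ) (hKn n)).isInducing) (fun z => ?_) ?_
      · filter_upwards [eventually_shellIndex_eq (hs'.comp continuous_subtype_val) z.2] with z' hz'
        exact PNat.eq (congrArg (· + 1) (hz' z'.2))
      · exact e.continuous.comp continuous_subtype_val
    refine h.approxOn_of_hasApprox hZ (hA p) hS ⟨Φ, hΦ⟩
      ⟨fun x => f (e.symm (inclusionMap (hKn x.1) x.2)), f.continuous.comp (e.symm.continuous.comp
        (continuous_sigma fun n => (isClosedEmbedding_inclusionMap (hKn n)).continuous))⟩ fun z => ?_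
    change f (e.symm (inclusionMap (hKn (Φ z).1) (Φ z).2)) = f z
    rw [hΦi, e.symm_apply_apply]
  refine h.approx_of_approxOn_univ hZ ?_
  have huniv : (univ : Set Z) = {z | s' z ∈ shell 0} ∪ {z | s' z ∈ shell 1} :=
    (eq_univ_of_forall fun z => mem_shell_zero_or_one ((Nat.cast_nonneg _).trans (hs'' z))).symm
  rw [huniv]
  exact h.approxOn_union hZ (hA 0) (hA 1) (key 0 f)
    isCov_univ fun f' _ => key 1 f'

end IsSetting

end Polyhedra

/-! ### Locally finite countable nerves as telescopes -/

section Telescope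

/-- The telescope over a family `𝒩` of finite sets of natural numbers: the pairs `(t, s)` such that
`t` is a point, in barycentric coordinates, of a simplex all of whose vertices are numbers not
greater than `s`, and all sets of vertices with nonzero coordinates belong to `𝒩`. The conditions
are written as closed conditions on `(t, s)`. -/
def telescope (𝒩 : Set (Finset ℕ)) : Set ((ℕ → ℝ) × ℝ) :=
  {p | (∀ i, p.1 i ∈ Icc (0 : ℝ) 1) ∧ 0 ≤ p.2 ∧ (∀ i : ℕ, p.1 i = 0 ∨ (i : ℝ) ≤ p.2) ∧
    (∀ m : ℕ, (m : ℝ) ≤ p.2 ∨ ∑ i ∈ Finset.range m, p.1 i = 1) ∧ ∀ B ∉ 𝒩, ∃ i ∈ B, p.1 i = 0}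

variable {𝒩 : Set (Finset ℕ)}

theorem isClosed_telescope : IsClosed (telescope 𝒩) := by
  have : telescope 𝒩 = (⋂ i, {p | p.1 i ∈ Icc (0 : ℝ) 1}) ∩ ({p | 0 ≤ p.2} ∩
      ((⋂ i : ℕ, {p | p.1 i = 0} ∪ {p | (i : ℝ) ≤ p.2}) ∩
      ((⋂ m : ℕ, {p | (m : ℝ) ≤ p.2} ∪ {p | ∑ i ∈ Finset.range m, p.1 i = 1}) ∩
        ⋂ B ∈ {B | B ∉ 𝒩}, ⋃ i ∈ B, {p | p.1 i = 0}))) := by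
    ext p
    simp only [telescope, mem_inter_iff, mem_iInter, mem_iUnion, mem_union, mem_ofPred_eq,
      exists_prop]
  rw [this]
  have hc : ∀ i, Continuous fun p : (ℕ → ℝ) × ℝ => p.1 i := fun i => by fun_prop
  refine (isClosed_iInter fun i => isClosed_Icc.preimage (hc i)).inter
    ((isClosed_le continuous_const continuous_snd).inter ((isClosed_iInter fun i => ?_).inter
      ((isClosed_iInter fun m => ?_).inter (isClosed_biInter fun B _ =>
        isClosed_biUnion_finset fun i _ => isClosed_eq (hc i) continuous_const))))
  · exact (isClosed_eq (hc i) continuous_const).union (isClosed_le continuous_const continuous_snd)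
  · exact (isClosed_le continuous_const continuous_snd).union
      (isClosed_eq (continuous_finsetSum _ fun i _ => hc i) continuous_const)

/-- The position in `ℕ → ℝ` and `ℝ` encoded by a point of `I^n`: the last coordinate is the
position in the interval `[n - 3, n - 2]`, the other ones are barycentric coordinates. -/
def decodeCube (n : ℕ+) (c : Cube n) : (ℕ → ℝ) × ℝ :=
  (fun i => if hi : i + 1 < n then (c ⟨i, by omega⟩ : ℝ) else 0,
    (n : ℝ) - 3 + c ⟨n - 1, Nat.sub_lt n.2 one_pos⟩)

theorem isClosedEmbedding_decodeCube (n : ℕ+) : IsClosedEmbedding (decodeCube n) := by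
  refine Continuous.isClosedEmbedding ?_ fun c d hcd => funext fun j => Subtype.ext ?_
  · refine .prodMk (continuous_pi fun i => ?_) (by fun_prop)
    by_cases hi : i + 1 < n
    · simp only [hi, dif_pos]
      fun_prop
    · simp only [hi, dif_neg, not_false_eq_true]
      exact continuous_const
  · by_cases hj : (j : ℕ) + 1 < n
    · have := congrFun (congrArg Prod.fst hcd) j
      simpa [decodeCube, hj] using this
    · have := congrArg Prod.snd hcd
      have hj' : j = ⟨n - 1, Nat.sub_lt n.2 one_pos⟩ := Fin.ext (by simp only; omega)
      rw [hj']
      simpa [decodeCube] using this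

/-- The part of the telescope lying over the shells of parity `e` is a closed subspace of the
disjoint union of all cubes. -/
theorem exists_isClosedEmbedding_telescope (𝒩 : Set (Finset ℕ)) (e : ℕ) :
    ∃ κ : {p : (ℕ → ℝ) × ℝ // p ∈ telescope 𝒩 ∧ p.2 ∈ shell e} → Σ n : ℕ+, Cube n,
      IsClosedEmbedding κ := by
  let k : {p : (ℕ → ℝ) × ℝ // p ∈ telescope 𝒩 ∧ p.2 ∈ shell e} → ℕ := fun p => shellIndex e p.1.2
  have hk : ∀ p, k p % 2 = e ∧ (k p : ℝ) ≤ p.1.2 ∧ p.1.2 ≤ k p + 1 := fun p => shellIndex_spec p.2.2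
  -- Over `[k, k + 1]` only the coordinates with indices `0, …, k + 1` can be nonzero; together with
  -- the position in the interval they form a point of `I^(k + 3)`.
  let κ : {p : (ℕ → ℝ) × ℝ // p ∈ telescope 𝒩 ∧ p.2 ∈ shell e} → Σ n : ℕ+, Cube n := fun p =>
    ⟨⟨k p + 3, Nat.succ_pos _⟩, fun j => if (j : ℕ) < k p + 2 then ⟨p.1.1 j, p.2.1.1 j⟩ else
      ⟨p.1.2 - k p, by linarith [(hk p).2.1], by linarith [(hk p).2.2]⟩⟩
  have hdec : ∀ p, decodeCube (κ p).1 (κ p).2 = p.1 := by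
    intro p
    refine Prod.ext (funext fun i => ?_) ?_
    · by_cases hi : i + 1 < k p + 3
      · have hi' : i < k p + 2 := by omega
        simp [decodeCube, κ, hi']
      · have h0 : p.1.1 i = 0 := by
          refine (p.2.1.2.2.1 i).resolve_right fun hle => ?_
          have h1 : (i : ℝ) ≤ (k p + 1 : ℕ) := by
            push_cast
            exact hle.trans (hk p).2.2
          have h2 := Nat.cast_le.1 h1
          omega
        have hi' : ¬ i < k p + 2 := by omega
        simp [decodeCube, κ, hi', h0]
    · simp [decodeCube, κ]
  have hκc : Continuous κ := by
    refine continuous_of_isInducing_sigma (fun n => (isClosedEmbedding_decodeCube n).isInducing)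
      (fun p => ?_) ?_
    · filter_upwards [eventually_shellIndex_eq (continuous_snd.comp continuous_subtype_val) p.2.2]
        with q hq
      exact PNat.eq (congrArg (· + 3) (hq q.2.2))
    · simp only [hdec]
      exact continuous_subtype_val
  refine ⟨κ, IsEmbedding.of_comp hκc
    (continuous_sigma fun n => (isClosedEmbedding_decodeCube n).continuous :
      Continuous fun z : Σ n : ℕ+, Cube n => decodeCube z.1 z.2) ?_, ?_⟩
  · have : (fun z : Σ n : ℕ+, Cube n => decodeCube z.1 z.2) ∘ κ = Subtype.val := funext hdec
    rw [this]
    exact IsEmbedding.subtypeVal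
  · have hrange : range κ = {z | 3 ≤ (z.1 : ℕ) ∧ ((z.1 : ℕ) - 3) % 2 = e ∧
        decodeCube z.1 z.2 ∈ telescope 𝒩} := by
      ext z
      constructor
      · rintro ⟨p, rfl⟩
        exact ⟨Nat.le_add_left _ _, (hk p).1, (hdec p).symm ▸ p.2.1⟩
      · rintro ⟨h3, he, hz⟩
        obtain ⟨n, c⟩ := z
        replace h3 : 3 ≤ (n : ℕ) := h3
        replace he : ((n : ℕ) - 3) % 2 = e := he
        have hlast := (c ⟨n - 1, Nat.sub_lt n.2 one_pos⟩).2
        have hn3 : ((n - 3 : ℕ) : ℝ) = (n : ℝ) - 3 := by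
          rw [Nat.cast_sub h3]
          norm_num
        have hr : (decodeCube n c).2 ∈ Icc ((n - 3 : ℕ) : ℝ) ((n - 3 : ℕ) + 1) := by
          rw [hn3]
          exact ⟨le_add_of_nonneg_right hlast.1, add_le_add_right hlast.2 _⟩
        have hsh : (decodeCube n c).2 ∈ shell e := mem_iUnion.2 ⟨⟨n - 3, he⟩, hr⟩
        let p : {p : (ℕ → ℝ) × ℝ // p ∈ telescope 𝒩 ∧ p.2 ∈ shell e} := ⟨decodeCube n c, hz, hsh⟩
        refine ⟨p, ?_⟩
        have hkp : k p = n - 3 := by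
          obtain ⟨h4, h5, h6⟩ := hk p
          have h7 : (k p : ℝ) < (n - 3 + 2 : ℕ) := by
            push_cast
            linarith [hr.2, show p.1.2 = (decodeCube n c).2 from rfl]
          have h8 : ((n - 3 : ℕ) : ℝ) < (k p + 2 : ℕ) := by
            push_cast
            linarith [hr.1, show p.1.2 = (decodeCube n c).2 from rfl]
          have h7' := Nat.cast_lt.1 h7
          have h8' := Nat.cast_lt.1 h8
          omega
        have h9 : (κ p).1 = n := PNat.eq (show k p + 3 = n by omega)
        have h10 : ∀ w : Σ n : ℕ+, Cube n, w.1 = n → decodeCube w.1 w.2 = decodeCube n c →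
            w = ⟨n, c⟩ := by
          rintro ⟨m, d⟩ hm hd
          obtain rfl : m = n := hm
          have hd' : decodeCube m d = decodeCube m c := hd
          rw [(isClosedEmbedding_decodeCube m).injective hd']
        exact h10 _ h9 (hdec p)
    rw [hrange, isClosed_sigma_iff]
    intro n
    by_cases hn : 3 ≤ (n : ℕ) ∧ ((n : ℕ) - 3) % 2 = e
    · convert (isClosed_telescope (𝒩 := 𝒩)).preimage (isClosedEmbedding_decodeCube n).continuous
        using 1
      ext c
      exact ⟨fun hc => hc.2.2, fun hc => ⟨hn.1, hn.2, hc⟩⟩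
    · convert isClosed_empty using 1
      ext c
      exact ⟨fun hc => hn ⟨hc.1, hc.2.1⟩, fun hc => hc.elim⟩

end Telescope

/-! ### Maps with Lindelöf images -/

section Lindelof

variable {Y : Type u} [TopologicalSpace Y] {T : Set TopCat.{u}}
  {D : ∀ X : TopCat.{u}, Set C(X, Y)} {X : Type u} [TopologicalSpace X]

/-- A map whose image is contained in a Lindelöf set is close to a map which factors through a
telescope. The telescope is the nerve of a countable cover, spread out along a half-line by a
function bounding from above the indices of the members of the cover containing a given point. -/
theorem IsANR.exists_factor_telescope (hY : IsANR Y) [Nonempty X] (f : C(X, Y)) {S : Set Y}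
    (hS : IsLindelof S) (hfS : range f ⊆ S) {𝒰 : Set (Set Y)} (h𝒰 : IsCov 𝒰) :
    ∃ (𝒩 : Set (Finset ℕ)) (Φ : C(X, telescope 𝒩)) (ψ : C(telescope 𝒩, Y)),
      Close 𝒰 f (fun x => ψ (Φ x)) := by
  classical
  have := hY.1
  have hYne : Nonempty Y := ‹Nonempty X›.map f
  obtain ⟨E, _, _, k, r, O, -, hr, hrk, hcov⟩ := hY.exists_convex_retraction
  obtain ⟨𝒱₀, h𝒱₀, hV₀⟩ := hcov 𝒰 h𝒰
  obtain ⟨𝒱, h𝒱, hbar⟩ := h𝒱₀.exists_barycentric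
  obtain ⟨c, hcc, hSc⟩ := hS.elim_countable_subcover (fun V : 𝒱 => (V : Set Y))
    (fun V => h𝒱.1 V V.2) fun y _ => by
      obtain ⟨V, hV, hy⟩ := h𝒱.exists_mem y
      exact mem_iUnion.2 ⟨⟨V, hV⟩, hy⟩
  have hcne : c.Nonempty := by
    obtain ⟨x⟩ := (inferInstance : Nonempty X)
    obtain ⟨V, hV, -⟩ := mem_iUnion₂.1 (hSc (hfS (mem_range_self x)))
    exact ⟨V, hV⟩
  obtain ⟨V, rfl⟩ := hcc.exists_eq_range hcne
  let y : ℕ → Y := fun n => if hn : (V n : Set Y).Nonempty then hn.some else hYne.some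
  have hy : ∀ n z, z ∈ (V n : Set Y) → y n ∈ (V n : Set Y) := fun n z hz => by
    have hn : (V n : Set Y).Nonempty := ⟨z, hz⟩
    simp only [y, hn, dif_pos]
    exact hn.some_mem
  let 𝒩 : Set (Finset ℕ) := {B | ∃ z, ∀ n ∈ B, z ∈ (V n : Set Y)}
  -- the affine map from the telescope to `E` sending the vertex `n` to `k (y n)`
  let A : telescope 𝒩 → E := fun p => ∑ i ∈ Finset.range (⌊p.1.2⌋₊ + 1), p.1.1 i • k (y i)
  have hsupp : ∀ (p : telescope 𝒩) (m : ℕ), p.1.2 < m → ∀ i, p.1.1 i ≠ 0 → i ∈ Finset.range m := by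
    intro p m hm i hi
    have h1 : (i : ℝ) < m := ((p.2.2.2.1 i).resolve_left hi).trans_lt hm
    exact Finset.mem_range.2 (Nat.cast_lt.1 h1)
  have hA : ∀ (p : telescope 𝒩) (m : ℕ), p.1.2 < m →
      A p = ∑ i ∈ Finset.range m, p.1.1 i • k (y i) := by
    intro p m hm
    refine Finset.sum_subset ?_ fun i _ hi => ?_
    · exact Finset.range_subset_range.2 (Nat.succ_le_of_lt ((Nat.floor_lt p.2.2.1).2 hm))
    · by_contra h0
      exact hi (hsupp p _ (by exact_mod_cast Nat.lt_floor_add_one p.1.2) i fun h => h0 (by simp [h]))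
  have hAr : ∀ (p : telescope 𝒩) (z : Y), (∀ i, p.1.1 i ≠ 0 → z ∈ (V i : Set Y)) →
      A p ∈ O ∧ ∃ U ∈ 𝒰, z ∈ U ∧ r (A p) ∈ U := by
    intro p z hz
    obtain ⟨W, hW, hst⟩ := hbar z
    obtain ⟨U, hU, hWU⟩ := hV₀ W hW
    have hlt : p.1.2 < (⌊p.1.2⌋₊ + 1 : ℕ) := by exact_mod_cast Nat.lt_floor_add_one p.1.2
    have hsum := (p.2.2.2.2.1 (⌊p.1.2⌋₊ + 1)).resolve_left (not_le.2 hlt)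
    have hmem : ∀ i, p.1.1 i ≠ 0 → z ∈ W ∧ y i ∈ W := fun i hi =>
      ⟨hst _ (V i).2 (hz i hi) (hz i hi), hst _ (V i).2 (hz i hi) (hy i z (hz i hi))⟩
    have hAW : A p ∈ convexHull ℝ (k '' W) := by
      have h1 : A p = ∑ i ∈ (Finset.range (⌊p.1.2⌋₊ + 1)).filter (fun i => p.1.1 i ≠ 0),
          p.1.1 i • k (y i) := by
        refine (Finset.sum_filter_of_ne (p := fun i => p.1.1 i ≠ 0) fun i _ hi h0 => hi ?_).symm
        rw [h0, zero_smul]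
      rw [h1]
      refine (convex_convexHull ℝ _).sum_mem (fun i _ => (p.2.1 i).1) ?_ fun i hi =>
        subset_convexHull ℝ _ (mem_image_of_mem k (hmem i (Finset.mem_filter.1 hi).2).2)
      rw [Finset.sum_filter_ne_zero]
      exact hsum
    have hzW : z ∈ W := by
      obtain ⟨i, -, hi⟩ : ∃ i ∈ Finset.range (⌊p.1.2⌋₊ + 1), p.1.1 i ≠ 0 :=
        Finset.exists_ne_zero_of_sum_ne_zero (by rw [hsum]; exact one_ne_zero)
      exact (hmem i hi).1
    have hzU := (hWU (subset_convexHull ℝ _ (mem_image_of_mem k hzW))).2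
    rw [mem_preimage, hrk] at hzU
    exact ⟨(hWU hAW).1, U, hU, hzU, (hWU hAW).2⟩
  have hAO : ∀ p, A p ∈ O := by
    intro p
    have hlt : p.1.2 < (⌊p.1.2⌋₊ + 1 : ℕ) := by exact_mod_cast Nat.lt_floor_add_one p.1.2
    have hB : (Finset.range (⌊p.1.2⌋₊ + 1)).filter (fun i => p.1.1 i ≠ 0) ∈ 𝒩 := by
      by_contra hB
      obtain ⟨i, hi, h0⟩ := p.2.2.2.2.2 _ hB
      exact (Finset.mem_filter.1 hi).2 h0
    obtain ⟨z, hz⟩ := hB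
    exact (hAr p z fun i hi => hz i (Finset.mem_filter.2 ⟨hsupp p _ hlt i hi, hi⟩)).1
  have hAc : Continuous A := by
    rw [continuous_iff_continuousAt]
    intro p
    have h1 : Continuous fun q : telescope 𝒩 =>
        ∑ i ∈ Finset.range (⌊p.1.2⌋₊ + 1), q.1.1 i • k (y i) :=
      continuous_finsetSum _ fun i _ => by fun_prop
    refine h1.continuousAt.congr ?_
    have h2 : Continuous fun q : telescope 𝒩 => q.1.2 := by fun_prop
    filter_upwards [h2.continuousAt.eventually (gt_mem_nhds (show p.1.2 < (⌊p.1.2⌋₊ + 1 : ℕ) by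
      exact_mod_cast Nat.lt_floor_add_one p.1.2))] with q hq
    exact (hA q _ hq).symm
  -- a partition of unity on the union of the cover, and a bound for the indices
  let _ : MetricSpace Y := TopologicalSpace.metrizableSpaceMetric Y
  let G : Set Y := ⋃ n, (V n : Set Y)
  obtain ⟨ρ, hρ⟩ := PartitionOfUnity.exists_isSubordinate (isClosed_univ (X := G))
    (fun n => (↑) ⁻¹' (V n : Set Y)) (fun n => (h𝒱.1 _ (V n).2).preimage continuous_subtype_val)
    fun z _ => by
      obtain ⟨n, hn⟩ := mem_iUnion.1 z.2
      exact mem_iUnion.2 ⟨n, hn⟩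
  have hρV : ∀ n z, ρ n z ≠ 0 → (z : Y) ∈ (V n : Set Y) := fun n z hz =>
    hρ n (subset_tsupport _ hz)
  obtain ⟨s, hs⟩ : ∃ s : C(G, ℝ), ∀ z, s z ∈ {a : ℝ | 0 ≤ a ∧ ∀ n : ℕ, ρ n z ≠ 0 → (n : ℝ) ≤ a} := by
    refine exists_continuous_forall_mem_convex_of_local_const (fun z => ?_) fun z => ?_
    · have hup : IsUpperSet {a : ℝ | 0 ≤ a ∧ ∀ n : ℕ, ρ n z ≠ 0 → (n : ℝ) ≤ a} :=
        fun a b hab ha => ⟨ha.1.trans hab, fun n hn => (ha.2 n hn).trans hab⟩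
      exact hup.ordConnected.convex
    · obtain ⟨N, hN, hfin⟩ := ρ.locallyFinite z
      obtain ⟨b, hb⟩ := hfin.bddAbove
      refine ⟨b, ?_⟩
      filter_upwards [hN] with w hw
      exact ⟨Nat.cast_nonneg _, fun n hn => Nat.cast_le.2 (hb ⟨w, hn, hw⟩)⟩
  have hfG : ∀ x, f x ∈ G := fun x => by
    obtain ⟨W, ⟨n, rfl⟩, hW⟩ := mem_iUnion₂.1 (hSc (hfS (mem_range_self x)))
    exact mem_iUnion.2 ⟨n, hW⟩
  have htel : ∀ z : G, ((fun n => ρ n z, s z) : (ℕ → ℝ) × ℝ) ∈ telescope 𝒩 := by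
    intro z
    refine ⟨fun n => ⟨ρ.nonneg n z, ρ.le_one n z⟩, (hs z).1, fun n => ?_, fun m => ?_, fun B hB => ?_⟩
    · exact or_iff_not_imp_left.2 ((hs z).2 n)
    · refine or_iff_not_imp_left.2 fun hm => ?_
      rw [← ρ.sum_eq_one (mem_univ z)]
      refine (finsum_eq_sum_of_support_subset _ fun n hn => ?_).symm
      exact Finset.mem_coe.2 (Finset.mem_range.2
        (Nat.cast_lt.1 (((hs z).2 n hn).trans_lt (not_le.1 hm))))
    · by_contra! hne
      exact hB ⟨z, fun n hn => hρV n z (hne n hn)⟩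
  refine ⟨𝒩, ⟨fun x => ⟨_, htel ⟨f x, hfG x⟩⟩, ?_⟩, ⟨fun p => r (A p), hr.comp_continuous hAc hAO⟩,
    fun x => ?_⟩
  · have hf' : Continuous fun x => (⟨f x, hfG x⟩ : G) := f.continuous.subtype_mk _
    refine Continuous.subtype_mk (.prodMk (continuous_pi fun n => ?_) (s.continuous.comp hf')) _
    exact (ρ n).continuous.comp hf'
  · exact (hAr _ (f x) fun i hi => hρV i ⟨f x, hfG x⟩ hi).2

/-- Maps with Lindelöf images can be approximated as soon as the disjoint union of all cubes has
SMAP, because telescopes are unions of two closed subspaces of the latter. -/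
theorem IsSetting.approx_of_isLindelof (h : IsSetting T D) (hX : TopCat.of X ∈ T)
    (hJ : HasSMAPAt T D (Σ n : ℕ+, Cube n)) (f : C(X, Y)) {S : Set Y} (hS : IsLindelof S)
    (hfS : range f ⊆ S) : Approx D f := by
  rcases isEmpty_or_nonempty X with hE | hne
  · exact h.approx_of_isEmpty hX f
  intro 𝒰 h𝒰
  have := h.isANR.1
  obtain ⟨𝒰', h𝒰', htr⟩ := h𝒰.exists_half
  obtain ⟨𝒩, Φ, ψ, hfψ⟩ := h.isANR.exists_factor_telescope f hS hfS h𝒰'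
  let j : ∀ e, {p : (ℕ → ℝ) × ℝ // p ∈ telescope 𝒩 ∧ p.2 ∈ shell e} → telescope 𝒩 := fun e p =>
    ⟨p.1, p.2.1⟩
  have hrange : ∀ e, range (j e) = {p | p.1.2 ∈ shell e} := by
    intro e
    ext p
    exact ⟨by rintro ⟨q, rfl⟩; exact q.2.2, fun hp => ⟨⟨p.1, p.2, hp⟩, rfl⟩⟩
  have hclosed : ∀ e, IsClosed {p : telescope 𝒩 | p.1.2 ∈ shell e} := fun e =>
    (isClosed_shell e).preimage (continuous_snd.comp continuous_subtype_val)
  have hj : ∀ e, IsClosedEmbedding (j e) := fun e =>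
    ⟨.of_comp (by fun_prop) continuous_subtype_val IsEmbedding.subtypeVal,
      hrange e ▸ hclosed e⟩
  have hcov : ∀ p : telescope 𝒩, p.1.2 ∈ shell 0 ∨ p.1.2 ∈ shell 1 := fun p =>
    mem_shell_zero_or_one p.2.2.1
  have happ : ∀ e, HasApprox T D {p : (ℕ → ℝ) × ℝ // p ∈ telescope 𝒩 ∧ p.2 ∈ shell e} := fun e =>
    let ⟨_, hκ⟩ := exists_isClosedEmbedding_telescope 𝒩 e
    h.hasApprox_of_isClosedEmbedding hJ hκ
  obtain ⟨P, _, hP, ⟨a⟩, hPa⟩ := happ 0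
  obtain ⟨Q, _, hQ, ⟨b⟩, hQb⟩ := happ 1
  have ha := (hj 0).comp a.isClosedEmbedding
  have hb := (hj 1).comp b.isClosedEmbedding
  obtain ⟨ψ', hψψ', hψP, hψQ⟩ := h.exists_close_of_union ha hb (by
    rw [a.surjective.range_comp, b.surjective.range_comp, hrange, hrange]
    exact eq_univ_of_forall hcov) hP hQ hPa hQb ψ h𝒰'
  refine ⟨ψ'.comp Φ, ?_, htr hfψ (hψψ'.comp Φ)⟩
  have hcl : ∀ e, IsClosed {x | (Φ x).1.2 ∈ shell e} := fun e => (hclosed e).preimage Φ.continuous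
  have huniv : {x | (Φ x).1.2 ∈ shell 0} ∪ {x | (Φ x).1.2 ∈ shell 1} = univ :=
    eq_univ_of_forall fun x => hcov (Φ x)
  refine h.restrict_univ hX ?_
  have key : ∀ (e : ℕ) {P : Type u} [TopologicalSpace P] (hP : TopCat.of P ∈ T)
      (a : P ≃ₜ {p : (ℕ → ℝ) × ℝ // p ∈ telescope 𝒩 ∧ p.2 ∈ shell e}) (g : C(P, Y)),
      g ∈ D (TopCat.of P) → (∀ p, g p = ψ' (j e (a p))) →
      (ψ'.comp Φ).restrict {x | (Φ x).1.2 ∈ shell e} ∈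
        D (TopCat.of {x | (Φ x).1.2 ∈ shell e}) := by
    intro e P _ hP a g hg hgψ
    have := h.comp_mem (h.of_isClosed hX (hcl e)) hP
      ⟨fun x => a.symm ⟨(Φ x.1).1, (Φ x.1).2, x.2⟩, by fun_prop⟩ hg
    convert this using 1
    ext x
    simp [hgψ, j]
  have := h.restrict_union hX (hcl 0) (hcl 1) (key 0 hP a _ hψP fun p => rfl)
    (key 1 hQ b _ hψQ fun p => rfl)
  exact h.restrict_mono hX isClosed_univ ((hcl 0).union (hcl 1)) huniv.ge this

end Lindelof

/-! ### Density -/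

section Density

variable {Y : Type u} [TopologicalSpace Y] {T : Set TopCat.{u}}
  {D : ∀ X : TopCat.{u}, Set C(X, Y)} {X : Type u} [TopologicalSpace X]

theorem limDense_of_approx (hD : ∀ f : C(X, Y), Approx D f) : LimDense (D (TopCat.of X)) := by
  let := limitationTopology X Y
  refine dense_iff_inter_open.2 fun O hO ⟨f, hf⟩ => ?_
  obtain ⟨𝒰, h𝒰, hfO⟩ := hO f hf
  obtain ⟨g, hg, hfg⟩ := hD f 𝒰 h𝒰
  exact ⟨g, hfO hfg, hg⟩

theorem isEmpty_of_faces_eq_empty {ι : Type u} {K : AbstractSimplicialComplex ι}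
    {τ : ComplexTopology} {Z : Type u} [TopologicalSpace Z] (e : Z ≃ₜ Realization K τ) (hK : ¬ K.faces.Nonempty) :
    IsEmpty Z :=
  ⟨fun z => hK ⟨_, (e z).supp_mem⟩⟩

end Density

end NormalSystems

theorem mainTheorem8 (τ : ComplexTopology) (Y : Type u) [TopologicalSpace Y] (hY : IsANR Y)
    (T : Set TopCat.{u}) (hT : ClosedHereditary T) (hTY : Corelated τ T Y)
    (D : ∀ X : TopCat.{u}, Set C(X, Y)) (hD : IsTransitiveNormal Y T D) :
    -- case (I)
    (((∀ X ∈ T, CompactSpace X ∧ T2Space X) ∨ LocallyCompactSpace Y) →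
      (∀ m : ℕ, (m : WithBot ℕ∞) ≤ dimMeet T Y → ∃ n ≥ m, HasSMAPAt T D (Cube n)) →
      ∀ X ∈ T, LimDense (D X)) ∧
    -- case (II)
    (IsStronglyNormal Y T D → ((∀ X ∈ T, FDT X) ∨ LocallyFDT Y) →
      (∀ m : ℕ, (m : WithBot ℕ∞) ≤ dimMeet T Y →
        ∀ (α : Type u) [Nonempty α] [TopologicalSpace α] [DiscreteTopology α],
          #α < compMeet T Y → ∃ n ≥ m, HasSMAPAt T D (Cube n × α)) →
      ∀ X ∈ T, LimDense (D X)) ∧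
    -- case (III)
    (((∀ X ∈ T, LindelofSpace X) ∨ LocallySeparable Y) →
      HasSMAPAt T D (Σ n : ℕ+, Cube n) →
      ∀ X ∈ T, LimDense (D X)) ∧
    -- case (IV)
    ((∀ (α : Type u) (e : α), #α < compMeet T Y → HasSMAPAt T D (SpaceJ e τ)) →
      ∀ X ∈ T, LimDense (D X)) := by
  obtain ⟨hDn, hDt⟩ := hD
  have h : IsSetting T D := ⟨hY, hT, fun hX => (hTY.1 _ hX).1, fun hX => (hTY.1 _ hX).2, hDn, hDt⟩
  have := hY.1
  refine ⟨fun hc hcube X hX => ?_, fun hstrong hc hcube X hX => ?_, fun hc hJ X hX => ?_,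
    fun hJ X hX => ?_⟩
  -- Compactness of the members of `T` or local compactness of `Y` makes the polyhedra finite.
  · refine limDense_of_approx (h.approx_of_corelated hTY hX
      fun ι K Z _ hZ e hιX hιY _ hdim _ _ f => ?_)
    by_cases hK : K.faces.Nonempty
    · have hι : #ι < ℵ₀ := by
        rcases hc with hc | hc
        · have := (hc X hX).1
          exact hιX.trans_le (comp_le_aleph0 X)
        · exact hιY.trans_le (compLoc_le_aleph0 Y)
      have := Cardinal.lt_aleph0_iff_finite.1 hι
      have := Fintype.ofFinite ι
      obtain ⟨m, hm, hσ⟩ := FiniteDimensional.exists_dim (K := K)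
        ⟨Fintype.card ι, fun σ _ => σ.card_le_univ⟩ hK
      obtain ⟨n, hn, hs⟩ := hcube m (hm.trans hdim)
      exact h.approx_of_finite hZ e (fun σ hσK => (hσ σ hσK).trans (Nat.add_le_add_right hn 1)) hs f
    · have := isEmpty_of_faces_eq_empty e hK
      exact h.approx_of_isEmpty hZ f
  · refine limDense_of_approx (h.approx_of_corelated hTY hX
      fun ι K Z _ hZ e _ _ hι hdim _ hfin f => ?_)
    by_cases hK : K.faces.Nonempty
    · obtain ⟨m, hm, hσ⟩ := (hfin (hc.imp_left fun hc => hc X hX)).exists_dim hK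
      exact h.approx_of_finiteDimensional hstrong.2 hZ e hσ (fun α _ _ _ hα =>
        hcube m (hm.trans hdim) α (hα.trans_lt (mk_finset_lt_compMeet hX hι))) f
    · have := isEmpty_of_faces_eq_empty e hK
      exact h.approx_of_isEmpty hZ f
  · refine limDense_of_approx fun f => ?_
    rcases hc with hc | hc
    · have := hc X hX
      exact h.approx_of_isLindelof hX hJ f (isLindelof_range f.continuous) Subset.rfl
    -- In a locally separable `Y` sufficiently small maps have separable, hence Lindelöf, images.
    · have h𝒱 : IsCov {V : Set Y | IsOpen V ∧ TopologicalSpace.IsSeparable V} := by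
        refine ⟨fun V hV => hV.1, eq_univ_of_forall fun y => ?_⟩
        obtain ⟨F, hF, hs⟩ := hc y
        exact ⟨interior F, ⟨isOpen_interior, (TopologicalSpace.IsSeparable.of_subtype F).mono
          interior_subset⟩, mem_interior_iff_mem_nhds.2 hF⟩
      refine h.approx_of_small hX hX .id h𝒱 (fun g ⟨V, hV, hgV⟩ => ?_) f
      let := TopologicalSpace.metrizableSpaceMetric Y
      have := hV.2.secondCountableTopology
      exact h.approx_of_isLindelof hX hJ g (isLindelof_iff_lindelofSpace.2 inferInstance)
        (subset_closure.trans hgV)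
  · refine limDense_of_approx (h.approx_of_corelated hTY hX
      fun ι K Z _ hZ e _ _ hι _ hK _ f => ?_)
    rcases isEmpty_or_nonempty ι with hE | ⟨⟨v⟩⟩
    · have := isEmpty_of_faces_eq_empty e fun ⟨σ, hσ⟩ =>
        (K.isRelLowerSet_faces hσ).1.ne_empty (Finset.eq_empty_of_isEmpty σ)
      exact h.approx_of_isEmpty hZ f
    · exact h.approx_of_locallyFiniteDimensional hZ e hK v (hJ ι v hι) f
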